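/- Let $k$ be a field, let $G$ be a finite simple graph with vertex set $V$, let $R = k[x_v : v \in V]$ with the standard grading, and let $I(G) = \langle x_a x_b : \{a,b\} \text{ an edge of } G\rangle \subseteq R$ be the edge ideal of $G$. Let $\beta_{i,j}(I(G)) = \dim_k \operatorname{Tor}_i^R(I(G),k)_j$ be its graded Betti numbers, where the graded vector space $\operatorname{Tor}_i^R(I(G),k)$ is the $i$-th homology of $F_\bullet \otimes_R k$ for a graded free resolution $F_\bullet$ of $I(G)$ (one exists, and the numbers below are finite and are the same for every choice of $F_\bullet$). Then $$\beta_{2,4}(I(G)) = \sum_{v \in V} \binom{\deg v}{3} - k_4(G) + k_{2,2}(G)$$ and $$\beta_{3,5}(I(G)) = \sum_{v \in V} \binom{\deg v}{4} - k_5(G) + k_{2,3}(G) + w_4(G) + d(G).$$ Here $k_n(G)$, $k_{n,m}(G)$, $w_4(G)$ and $d(G)$ are the numbers of induced subgraphs of $G$ (that is, of vertex sets $S \subseteq V$ whose induced subgraph $G_S$ is) isomorphic to the complete graph $K_n$, to the complete bipartite graph $K_{n,m}$, to the wheel $W_4$ (the cycle on four vertices together with a fifth vertex adjacent to all four of them),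 and to the graph $D$, respectively, where $D$ has the vertices $0,1,2,3,4$ and the seven edges $\{0,1\}, \{0,2\}, \{1,3\}, \{2,3\}, \{1,4\}, \{2,4\}, \{3,4\}$. -/

import Mathlib

/-!
Graded Betti numbers of ideals in a polynomial ring, edge ideals of graphs, and the numbers of
induced subgraphs of a given isomorphism type.
-/

universe u v w

/-- A free module `⨁_b R(-deg b)` over `R = k[x_v : v ∈ V]` is written `B →₀ R`, where the basis
vector `b` has degree `deg b`. Its element `f` is homogeneous of degree `j` when every monomial `m`
of every coordinate `f b` satisfies `deg b + deg m = j`. -/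
def IsHomogeneousVec {k : Type u} [Field k] {V : Type v} {B : Type w}
    (deg : B → ℤ) (f : B →₀ MvPolynomial V k) (j : ℤ) : Prop :=
  ∀ b : B, ∀ m ∈ (f b).support, deg b + (m.degree : ℤ) = j

/-- A graded free resolution
`⋯ → ⨁_{b ∈ B 1} R(-deg b) → ⨁_{b ∈ B 0} R(-deg b) → I → 0`
of an ideal `I` of `R = k[x_v : v ∈ V]` with its standard grading (each variable has degree 1):
an exact sequence of graded free modules, whose maps are homogeneous of degree 0. -/
structure GradedFreeResolution {k : Type u} [Field k] {V : Type v}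
    (I : Ideal (MvPolynomial V k)) where
  /-- the homogeneous basis of the `i`-th free module -/
  B : ℕ → Type w
  /-- the degrees of the basis elements -/
  deg : (i : ℕ) → B i → ℤ
  /-- the differentials -/
  d : (i : ℕ) → (B (i + 1) →₀ MvPolynomial V k) →ₗ[MvPolynomial V k] (B i →₀ MvPolynomial V k)
  /-- the augmentation, whose image is `I` -/
  aug : (B 0 →₀ MvPolynomial V k) →ₗ[MvPolynomial V k] MvPolynomial V k
  d_homogeneous : ∀ (i : ℕ) (b : B (i + 1)),
    IsHomogeneousVec (deg i) (d i (Finsupp.single b 1)) (deg (i + 1) b)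
  aug_homogeneous : ∀ (b : B 0), ∀ m ∈ (aug (Finsupp.single b 1)).support,
    (m.degree : ℤ) = deg 0 b
  range_aug : LinearMap.range aug = I
  exact_zero : LinearMap.ker aug = LinearMap.range (d 0)
  exact_succ : ∀ i : ℕ, LinearMap.ker (d i) = LinearMap.range (d (i + 1))

namespace GradedFreeResolution

variable {k : Type u} [Field k] {V : Type v} {I : Ideal (MvPolynomial V k)}

/-- The differential of `F ⊗_R k`, where `k = R / (x_v : v ∈ V)`. The module `F_i ⊗_R k` is the
`k`-vector space with basis `B i`, and the entries of the matrix of the differential are reduced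
modulo the variables, that is, replaced by their constant coefficients. -/
noncomputable def tensorD (F : GradedFreeResolution.{u, v, w} I) (i : ℕ) :
    (F.B (i + 1) →₀ k) →ₗ[k] (F.B i →₀ k) :=
  Finsupp.linearCombination k fun b : F.B (i + 1) =>
    Finsupp.mapRange MvPolynomial.constantCoeff (map_zero _) (F.d i (Finsupp.single b 1))

/-- The degree `j` part of `F_i ⊗_R k`: it is spanned by the basis elements of degree `j`. -/
def tensorPart (F : GradedFreeResolution.{u, v, w} I) (i : ℕ) (j : ℤ) :
    Submodule k (F.B i →₀ k) :=
  Finsupp.supported k k {b | F.deg i b = j}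

/-- The degree `j` part of the `i`-cycles of `F ⊗_R k`. -/
noncomputable def cycles (F : GradedFreeResolution.{u, v, w} I) :
    (i : ℕ) → (j : ℤ) → Submodule k (F.B i →₀ k)
  | 0, j => F.tensorPart 0 j
  | i + 1, j => F.tensorPart (i + 1) j ⊓ LinearMap.ker (F.tensorD i)

/-- The degree `j` part of the `i`-boundaries of `F ⊗_R k`. -/
noncomputable def boundaries (F : GradedFreeResolution.{u, v, w} I) (i : ℕ) (j : ℤ) :
    Submodule k (F.B i →₀ k) :=
  (F.tensorPart (i + 1) j).map (F.tensorD i)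

/-- `Tor_i^R(I, k)_j`, computed from the graded free resolution `F` of `I`: the degree `j` part of
the `i`-th homology of `F ⊗_R k`, that is, cycles modulo boundaries. (The boundaries are cycles, and
the quotient is formed as the image of the cycles in `(F_i ⊗_R k) / boundaries`.) -/
noncomputable def Tor (F : GradedFreeResolution.{u, v, w} I) (i : ℕ) (j : ℤ) :
    Submodule k ((F.B i →₀ k) ⧸ F.boundaries i j) :=
  (F.cycles i j).map (F.boundaries i j).mkQ

/-- The graded Betti number `β_{i,j}(I) = dim_k Tor_i^R(I, k)_j`. -/
noncomputable def betti (F : GradedFreeResolution.{u, v, w} I) (i : ℕ) (j : ℤ) : ℕ :=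
  Module.finrank k (F.Tor i j)

end GradedFreeResolution

namespace SimpleGraph

/-- The edge ideal `I(G)`, generated by the monomials `x_a x_b` for the edges `{a, b}` of `G`. -/
noncomputable def edgeIdeal (k : Type u) [Field k] {V : Type v} (G : SimpleGraph V) :
    Ideal (MvPolynomial V k) :=
  Ideal.span {p | ∃ a b : V, G.Adj a b ∧ p = MvPolynomial.X a * MvPolynomial.X b}

/-- The number of induced subgraphs of `G` that are isomorphic to `H`, that is, the number of
sets `S` of vertices such that the subgraph of `G` induced on `S` is isomorphic to `H`. -/
noncomputable def inducedCount {V : Type v} {W : Type w} (G : SimpleGraph V)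
    (H : SimpleGraph W) : ℕ :=
  {S : Set V | Nonempty (G.induce S ≃g H)}.ncard

/-- The wheel `W_n`: the cycle `C_n` together with a further vertex `none`, which is adjacent to
all vertices of the cycle. -/
def wheelGraph (n : ℕ) : SimpleGraph (Option (Fin n)) where
  Adj
    | some a, some b => (cycleGraph n).Adj a b
    | some _, none => True
    | none, some _ => True
    | none, none => False
  symm := ⟨by
    rintro (_ | a) (_ | b) h
    · exact h
    · trivial
    · trivial
    · exact SimpleGraph.Adj.symm h⟩
  loopless := ⟨by
    rintro (_ | a) h
    · exact h
    · exact (cycleGraph n).loopless.irrefl a h⟩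

/-- The graph `D`: a square with corners `0 = (0,0)`, `1 = (1,0)`, `2 = (0,1)`, `3 = (1,1)` and
with the centre `4`, which is joined to the corners `1`, `2` and `3`. -/
def graphD : SimpleGraph (Fin 5) :=
  fromEdgeSet {s(0, 1), s(0, 2), s(1, 3), s(2, 3), s(1, 4), s(2, 4), s(3, 4)}

end SimpleGraph

/-! Tor is balanced: `Tor_i(I, k)` is also the homology of the Koszul complex `I ⊗ Λ` of the
variables. For an edge ideal in total degree `i + 2`, the term `I ⊗ Λ^(i+1)` would need linear forms
in `I` and so vanishes. There are then no boundaries, and `Tor_i(I, k)_(i+2)` is the space of Koszul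
cycles with quadratic coefficients in `I`. `nonempty_tor_equiv_koszulCycles` proves this for an
arbitrary resolution `F` by chasing staircases in the double complex of `F` and the Koszul complex,
whose columns are exact by `koszulD_koszulHomotopy`.

Such a cycle is a combination of terms `x_a x_b ⊗ e_T` with `ab` an edge and `|T| = i`. It has no
component in a multidegree that is not squarefree. In the multidegree of a vertex set `S` with `i +
2` elements, its sign-corrected coefficients are an antisymmetric function `f(a, b)` on pairs from
`S`. The cycle condition reads `f(a, b) + f(b, c) + f(c, a) = 0`, so `f(a, b) = g(a) - g(b)` for a
potential `g`, unique once normalized at a base point. Since `f` vanishes on non-edges, `g` is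
constant on the components of the complement of `G_S`. Hence the Betti number is the sum over `S` of
(number of components of that complement) - 1, which is `betti_edgeIdeal_linear`.

What remains is counting. With at most five vertices, a graph has at most two components containing
an edge. So the summand is the number of isolated vertices of the complement, minus 1 if the
complement has no edge, plus 1 if it has two separated edges. Isolated vertices of the complement
are vertices of `S` joined to all the others, and over all `S` they contribute binomials of degrees.
An edgeless complement means that `G_S` is complete. Two separated edges on four vertices mean
`K_{2,2}`; on five vertices they mean `K_{2,3}`, `W_4` or `D`, according to how the fifth vertex is
attached (`hasSeparatedEdges_compl_iff`). -/

/-! ### Homogeneous parts of vectors in graded free modules. -/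

open MvPolynomial in
/-- The projection of `⨁_b R(-deg b)` onto its part of degree `j`. -/
noncomputable def homogeneousPart {k : Type u} [Field k] {V : Type v} {B : Type w}
    (deg : B → ℤ) (j : ℤ) (f : B →₀ MvPolynomial V k) : B →₀ MvPolynomial V k :=
  Finsupp.onFinset f.support
    (fun b => if 0 ≤ j - deg b then homogeneousComponent (j - deg b).toNat (f b) else 0)
    (fun b h => by
      rw [Finsupp.mem_support_iff]
      intro h0
      simp [h0] at h)

section HomogeneousPart

open MvPolynomial

variable {k : Type u} [Field k] {V : Type v} {B : Type w} {B' : Type*}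

theorem coeff_homogeneousPart (deg : B → ℤ) (j : ℤ) (f : B →₀ MvPolynomial V k) (b : B)
    (m : V →₀ ℕ) :
    coeff m (homogeneousPart deg j f b) =
      if deg b + (m.degree : ℤ) = j then coeff m (f b) else 0 := by
  simp only [homogeneousPart, Finsupp.onFinset_apply]
  split_ifs with h1 h2 h2
  · rw [coeff_homogeneousComponent, if_pos (by omega)]
  · rw [coeff_homogeneousComponent, if_neg (by omega)]
  · omega
  · simp

theorem finsupp_mvPolynomial_ext {f g : B →₀ MvPolynomial V k}
    (h : ∀ b m, coeff m (f b) = coeff m (g b)) : f = g :=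
  Finsupp.ext fun b => MvPolynomial.ext _ _ (h b)

theorem isHomogeneousVec_iff {deg : B → ℤ} {f : B →₀ MvPolynomial V k} {j : ℤ} :
    IsHomogeneousVec deg f j ↔ ∀ b m, coeff m (f b) ≠ 0 → deg b + (m.degree : ℤ) = j := by
  simp [IsHomogeneousVec, MvPolynomial.mem_support_iff]

theorem isHomogeneousVec_homogeneousPart (deg : B → ℤ) (j : ℤ) (f : B →₀ MvPolynomial V k) :
    IsHomogeneousVec deg (homogeneousPart deg j f) j := by
  rw [isHomogeneousVec_iff]
  intro b m h
  rw [coeff_homogeneousPart] at h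
  by_contra h'
  exact h (if_neg h')

theorem homogeneousPart_of_isHomogeneousVec {deg : B → ℤ} {f : B →₀ MvPolynomial V k} {e : ℤ}
    (h : IsHomogeneousVec deg f e) (j : ℤ) :
    homogeneousPart deg j f = if e = j then f else 0 := by
  rw [isHomogeneousVec_iff] at h
  refine finsupp_mvPolynomial_ext fun b m => ?_
  rw [coeff_homogeneousPart]
  by_cases h0 : coeff m (f b) = 0
  · split_ifs <;> simp [h0]
  · rw [h b m h0]
    split_ifs <;> simp

theorem homogeneousPart_add (deg : B → ℤ) (j : ℤ) (f g : B →₀ MvPolynomial V k) :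
    homogeneousPart deg j (f + g) = homogeneousPart deg j f + homogeneousPart deg j g := by
  refine finsupp_mvPolynomial_ext fun b m => ?_
  simp only [Finsupp.add_apply, coeff_add, coeff_homogeneousPart]
  split_ifs <;> simp

theorem homogeneousPart_zero (deg : B → ℤ) (j : ℤ) :
    homogeneousPart deg j (0 : B →₀ MvPolynomial V k) = 0 := by
  refine finsupp_mvPolynomial_ext fun b m => ?_
  simp [coeff_homogeneousPart]

theorem isHomogeneousVec_monomial_smul {deg : B → ℤ} {f : B →₀ MvPolynomial V k} {e : ℤ}
    (h : IsHomogeneousVec deg f e) (m : V →₀ ℕ) (r : k) :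
    IsHomogeneousVec deg (monomial m r • f) (e + m.degree) := by
  rw [isHomogeneousVec_iff] at h ⊢
  intro b n hn
  rw [Finsupp.smul_apply, smul_eq_mul, coeff_monomial_mul'] at hn
  split_ifs at hn with hle
  · have := h b _ (right_ne_zero_of_mul hn)
    have h2 : n.degree = (n - m).degree + m.degree := by
      rw [← map_add, tsub_add_cancel_of_le hle]
    rw [h2]
    push_cast
    omega
  · exact absurd rfl hn

theorem isHomogeneousVec_single (deg : B → ℤ) (b : B) :
    IsHomogeneousVec deg (Finsupp.single b (1 : MvPolynomial V k)) (deg b) := by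
  classical
  rw [isHomogeneousVec_iff]
  intro b' m h
  by_cases hb : b = b'
  · subst hb
    rw [Finsupp.single_eq_same, coeff_one] at h
    split_ifs at h with hm
    · subst hm
      simp
    · exact absurd rfl h
  · rw [Finsupp.single_eq_of_ne (Ne.symm hb)] at h
    simp at h

/-- Linear maps that respect the degrees of the basis vectors commute with the projections. -/
theorem map_homogeneousPart {deg : B → ℤ} {deg' : B' → ℤ}
    (D : (B →₀ MvPolynomial V k) →ₗ[MvPolynomial V k] (B' →₀ MvPolynomial V k))
    (hD : ∀ b, IsHomogeneousVec deg' (D (Finsupp.single b 1)) (deg b)) (j : ℤ)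
    (f : B →₀ MvPolynomial V k) :
    D (homogeneousPart deg j f) = homogeneousPart deg' j (D f) := by
  induction f using Finsupp.induction_linear with
  | zero => simp [homogeneousPart_zero]
  | add f g hf hg => simp [homogeneousPart_add, hf, hg]
  | single b p =>
    induction p using MvPolynomial.induction_on' with
    | add p q hp hq => simp [homogeneousPart_add, hp, hq]
    | monomial m r =>
      have h1 : Finsupp.single b (monomial m r) =
          (monomial m r : MvPolynomial V k) • Finsupp.single b (1 : MvPolynomial V k) := by
        rw [Finsupp.smul_single, smul_eq_mul, mul_one]
      rw [h1, homogeneousPart_of_isHomogeneousVec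
        (isHomogeneousVec_monomial_smul (isHomogeneousVec_single deg b) m r), map_smul,
        homogeneousPart_of_isHomogeneousVec (isHomogeneousVec_monomial_smul (hD b) m r)]
      split_ifs
      · rw [map_smul]
      · rw [map_zero]

theorem isHomogeneousVec_map {deg : B → ℤ} {deg' : B' → ℤ}
    (D : (B →₀ MvPolynomial V k) →ₗ[MvPolynomial V k] (B' →₀ MvPolynomial V k))
    (hD : ∀ b, IsHomogeneousVec deg' (D (Finsupp.single b 1)) (deg b)) {j : ℤ}
    {f : B →₀ MvPolynomial V k} (hf : IsHomogeneousVec deg f j) :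
    IsHomogeneousVec deg' (D f) j := by
  have h := map_homogeneousPart D hD j f
  rw [homogeneousPart_of_isHomogeneousVec hf, if_pos rfl] at h
  rw [h]
  exact isHomogeneousVec_homogeneousPart _ _ _

/-- Any preimage may be replaced by its part of degree `j`, because `D` commutes with the
projections. -/
theorem exists_isHomogeneousVec_preimage {deg : B → ℤ} {deg' : B' → ℤ}
    (D : (B →₀ MvPolynomial V k) →ₗ[MvPolynomial V k] (B' →₀ MvPolynomial V k))
    (hD : ∀ b, IsHomogeneousVec deg' (D (Finsupp.single b 1)) (deg b)) {j : ℤ}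
    {g : B' →₀ MvPolynomial V k} (hg : IsHomogeneousVec deg' g j) (hr : g ∈ LinearMap.range D) :
    ∃ f, IsHomogeneousVec deg f j ∧ D f = g := by
  obtain ⟨f, rfl⟩ := hr
  refine ⟨homogeneousPart deg j f, isHomogeneousVec_homogeneousPart _ _ _, ?_⟩
  rw [map_homogeneousPart D hD, homogeneousPart_of_isHomogeneousVec hg, if_pos rfl]

end HomogeneousPart

/-! ### The Koszul complex of the variables. -/

section KoszulSign

variable {V : Type v} [Fintype V]

/-- The sign of `e_v ∧ e_T` in the exterior algebra, for some fixed order of the vertices. -/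
noncomputable def koszulSign (k : Type u) [Field k] (x : V) (T : Finset V) : k :=
  (-1) ^ (T.filter fun y => Fintype.equivFin V y < Fintype.equivFin V x).card

variable {k : Type u} [Field k]

theorem koszulSign_mul_self (x : V) (T : Finset V) :
    koszulSign k x T * koszulSign k x T = 1 := by
  rw [koszulSign, ← mul_pow]
  simp

theorem koszulSign_ne_zero (x : V) (T : Finset V) : koszulSign k x T ≠ 0 := by
  intro h
  simpa [h] using koszulSign_mul_self (k := k) x T

/-- This is `e_x ∧ e_y = -e_y ∧ e_x`: inserting the smaller of the two vertices adds one to the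
count for the larger, and inserting the larger does not affect the count for the smaller. -/
theorem koszulSign_swap [DecidableEq V] {x y : V} {T : Finset V} (h : x ≠ y) (hx : x ∉ T)
    (hy : y ∉ T) :
    koszulSign k x T * koszulSign k y (insert x T) =
      -(koszulSign k y T * koszulSign k x (insert y T)) := by
  wlog hlt : Fintype.equivFin V x < Fintype.equivFin V y generalizing x y
  · have h2 : Fintype.equivFin V y < Fintype.equivFin V x :=
      lt_of_le_of_ne (not_lt.1 hlt) fun h' => h ((Fintype.equivFin V).injective h').symm
    rw [this h.symm hy hx h2, neg_neg]
  · have h1 : x ∉ T.filter fun z => Fintype.equivFin V z < Fintype.equivFin V y := by simp [hx]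
    simp only [koszulSign, Finset.filter_insert, if_pos hlt, if_neg hlt.not_gt,
      Finset.card_insert_of_notMem h1, pow_succ]
    ring

end KoszulSign

section Koszul

open MvPolynomial

variable {k : Type u} [Field k] {V : Type v} [Fintype V] [DecidableEq V]

/-- The differential of the Koszul complex of the variables with coefficients in `M`. The chain
`∑_T c(T) e_T` is written as the function `c`. -/
noncomputable def koszulD (k : Type u) [Field k] {V : Type v} [Fintype V] [DecidableEq V]
    (M : Type*) [AddCommGroup M] [Module (MvPolynomial V k) M] :
    (Finset V → M) →ₗ[MvPolynomial V k] (Finset V → M) where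
  toFun c T := ∑ x ∈ Tᶜ, monomial (Finsupp.single x 1) (koszulSign k x T) • c (insert x T)
  map_add' c c' := by
    ext T
    simp [Finset.sum_add_distrib]
  map_smul' r c := by
    ext T
    simp [Finset.smul_sum, smul_comm r]

variable {M N : Type*} [AddCommGroup M] [Module (MvPolynomial V k) M]
  [AddCommGroup N] [Module (MvPolynomial V k) N]

theorem koszulD_apply (c : Finset V → M) (T : Finset V) :
    koszulD k M c T =
      ∑ x ∈ Tᶜ, monomial (Finsupp.single x 1) (koszulSign k x T) • c (insert x T) := rfl

theorem koszulD_comp_map (D : M →ₗ[MvPolynomial V k] N) (c : Finset V → M) :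
    koszulD k N (fun T => D (c T)) = fun T => D (koszulD k M c T) := by
  ext T
  simp [koszulD_apply]

/-- The terms for `(x, y)` and `(y, x)` cancel by `koszulSign_swap`. -/
theorem koszulD_koszulD (c : Finset V → M) : koszulD k M (koszulD k M c) = 0 := by
  ext T
  simp only [koszulD_apply, Finset.smul_sum, Pi.zero_apply]
  rw [Finset.sum_sigma']
  refine Finset.sum_involution (fun p _ => ⟨p.2, p.1⟩) ?_ ?_ ?_ ?_
  · rintro ⟨x, y⟩ hp
    simp only [Finset.mem_sigma, Finset.mem_compl, Finset.mem_insert, not_or] at hp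
    obtain ⟨hx, hy, hyT⟩ := hp
    simp only [smul_smul, monomial_mul]
    rw [koszulSign_swap (Ne.symm hy) hx hyT, Finset.insert_comm x y,
      add_comm (Finsupp.single x 1) (Finsupp.single y 1), ← add_smul, ← map_add, neg_add_cancel,
      map_zero, zero_smul]
  · rintro ⟨x, y⟩ hp _ h
    simp only [Finset.mem_sigma, Finset.mem_compl, Finset.mem_insert, not_or] at hp
    simp only [Sigma.mk.injEq] at h
    exact hp.2.1 h.1
  · rintro ⟨x, y⟩ hp
    simp only [Finset.mem_sigma, Finset.mem_compl, Finset.mem_insert, not_or] at hp ⊢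
    exact ⟨hp.2.2, Ne.symm hp.2.1, hp.1⟩
  · rintro ⟨x, y⟩ hp
    rfl

end Koszul

/-! ### Exactness of the Koszul complex with free coefficients. -/

section KoszulExact

open MvPolynomial

variable {k : Type u} [Field k] {V : Type v} {B : Type w} {B' : Type*}

/-- The chains of the Koszul complex with coefficients in `⨁_b R(-deg b)` of exterior degree `q`
and of total degree `j`. -/
def koszulPart (k : Type u) [Field k] {V : Type v} {B : Type w} (deg : B → ℤ) (q : ℕ) (j : ℤ) :
    Submodule k (Finset V → B →₀ MvPolynomial V k) where
  carrier := {c | ∀ T b m, coeff m (c T b) ≠ 0 → T.card = q ∧ deg b + m.degree + q = j}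
  zero_mem' T b m h := by simp at h
  add_mem' {c c'} hc hc' T b m h := by
    rw [Pi.add_apply, Finsupp.add_apply, coeff_add] at h
    by_cases h0 : coeff m (c T b) = 0
    · rw [h0, zero_add] at h
      exact hc' T b m h
    · exact hc T b m h0
  smul_mem' r c hc T b m h := by
    rw [Pi.smul_apply, Finsupp.smul_apply, coeff_smul, smul_eq_mul] at h
    exact hc T b m (right_ne_zero_of_mul h)

theorem apply_eq_zero_of_mem_koszulPart {deg : B → ℤ} {q : ℕ} {j : ℤ}
    {c : Finset V → B →₀ MvPolynomial V k} (hc : c ∈ koszulPart k deg q j) {T : Finset V}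
    (hT : T.card ≠ q) : c T = 0 := by
  refine finsupp_mvPolynomial_ext fun b m => ?_
  by_contra h
  exact hT (hc T b m (by simpa using h)).1

theorem isHomogeneousVec_of_mem_koszulPart {deg : B → ℤ} {q : ℕ} {j : ℤ}
    {c : Finset V → B →₀ MvPolynomial V k} (hc : c ∈ koszulPart k deg q j) (T : Finset V) :
    IsHomogeneousVec deg (c T) (j - q) := by
  rw [isHomogeneousVec_iff]
  intro b m h
  have := (hc T b m h).2
  omega

theorem mem_koszulPart_of {deg : B → ℤ} {q : ℕ} {j : ℤ}
    {c : Finset V → B →₀ MvPolynomial V k} (h0 : ∀ T, T.card ≠ q → c T = 0)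
    (h : ∀ T, IsHomogeneousVec deg (c T) (j - q)) : c ∈ koszulPart k deg q j := by
  intro T b m hm
  have h1 := isHomogeneousVec_iff.1 (h T) b m hm
  refine ⟨?_, by omega⟩
  by_contra hT
  simp [h0 T hT] at hm

theorem map_mem_koszulPart {deg : B → ℤ} {deg' : B' → ℤ}
    (D : (B →₀ MvPolynomial V k) →ₗ[MvPolynomial V k] (B' →₀ MvPolynomial V k))
    (hD : ∀ b, IsHomogeneousVec deg' (D (Finsupp.single b 1)) (deg b)) {q : ℕ} {j : ℤ}
    {c : Finset V → B →₀ MvPolynomial V k} (hc : c ∈ koszulPart k deg q j) :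
    (fun T => D (c T)) ∈ koszulPart k deg' q j :=
  mem_koszulPart_of (fun T hT => by rw [apply_eq_zero_of_mem_koszulPart hc hT, map_zero])
    fun T => isHomogeneousVec_map D hD (isHomogeneousVec_of_mem_koszulPart hc T)

theorem exists_preimage_mem_koszulPart {deg : B → ℤ} {deg' : B' → ℤ}
    (D : (B →₀ MvPolynomial V k) →ₗ[MvPolynomial V k] (B' →₀ MvPolynomial V k))
    (hD : ∀ b, IsHomogeneousVec deg' (D (Finsupp.single b 1)) (deg b)) {q : ℕ} {j : ℤ}
    {c : Finset V → B' →₀ MvPolynomial V k} (hc : c ∈ koszulPart k deg' q j)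
    (hr : ∀ T, c T ∈ LinearMap.range D) :
    ∃ y ∈ koszulPart k deg q j, (fun T => D (y T)) = c := by
  choose y hy hyc using fun T =>
    exists_isHomogeneousVec_preimage D hD (isHomogeneousVec_of_mem_koszulPart hc T) (hr T)
  -- The chosen preimages of zero outside exterior degree `q` need not vanish, so they are cut off.
  refine ⟨fun T => if T.card = q then y T else 0, mem_koszulPart_of (fun T hT => if_neg hT) ?_, ?_⟩
  · intro T
    split_ifs
    · exact hy T
    · simp [isHomogeneousVec_iff]
  · ext1 T
    beta_reduce
    split_ifs with hT
    · exact hyc T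
    · rw [map_zero, apply_eq_zero_of_mem_koszulPart hc hT]

/-- The exponent of the squarefree monomial `∏_{x ∈ T} x`. -/
noncomputable def indicatorExponent (T : Finset V) : V →₀ ℕ := ∑ x ∈ T, Finsupp.single x 1

theorem degree_indicatorExponent (T : Finset V) : (indicatorExponent T).degree = T.card := by
  simp [indicatorExponent]

open Classical in
/-- A variable that divides the monomial with the given exponent, if there is one. -/
noncomputable def chosenVariable (m : V →₀ ℕ) : Option V :=
  if h : ∃ x, m x ≠ 0 then some h.choose else none

theorem ne_zero_of_chosenVariable {m : V →₀ ℕ} {x : V} (h : chosenVariable m = some x) :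
    m x ≠ 0 := by
  unfold chosenVariable at h
  split_ifs at h with h0
  · cases h
    exact h0.choose_spec

theorem exists_chosenVariable {m : V →₀ ℕ} (h : m ≠ 0) : ∃ x, chosenVariable m = some x := by
  have h0 : ∃ x, m x ≠ 0 := by
    by_contra! h'
    exact h (Finsupp.ext h')
  exact ⟨_, dif_pos h0⟩

variable [DecidableEq V]

theorem indicatorExponent_insert {x : V} {T : Finset V} (h : x ∉ T) :
    indicatorExponent (insert x T) = Finsupp.single x 1 + indicatorExponent T :=
  Finset.sum_insert h

theorem indicatorExponent_apply (T : Finset V) (x : V) :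
    indicatorExponent T x = if x ∈ T then 1 else 0 := by
  simp [indicatorExponent, Finsupp.finsetSum_apply, Finsupp.single_apply]

/-- Division of a polynomial by the variable `x`, keeping only the monomials whose product with
`T` has `x` as its chosen variable. -/
noncomputable def contractVariable (x : V) (T : Finset V) (f : MvPolynomial V k) :
    MvPolynomial V k :=
  ∑ m ∈ (f.divMonomial (Finsupp.single x 1)).support,
    if chosenVariable (m + indicatorExponent T) = some x then
      monomial m (coeff (m + Finsupp.single x 1) f) else 0

theorem coeff_contractVariable (x : V) (T : Finset V) (f : MvPolynomial V k) (m : V →₀ ℕ) :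
    coeff m (contractVariable x T f) =
      if chosenVariable (m + indicatorExponent T) = some x then
        coeff (m + Finsupp.single x 1) f else 0 := by
  rw [contractVariable, coeff_sum, Finset.sum_eq_single m]
  · split_ifs <;> simp
  · intro n _ hn
    split_ifs
    · rw [coeff_monomial, if_neg hn]
    · simp
  · intro h
    rw [MvPolynomial.mem_support_iff, not_not, coeff_divMonomial, add_comm] at h
    rw [h]
    simp

theorem contractVariable_zero (x : V) (T : Finset V) :
    contractVariable x T (0 : MvPolynomial V k) = 0 := by
  ext m
  simp [coeff_contractVariable]

variable [Fintype V]

/-- The contracting homotopy of the Koszul complex. -/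
noncomputable def koszulHomotopy (c : Finset V → B →₀ MvPolynomial V k) :
    Finset V → B →₀ MvPolynomial V k :=
  fun T => ∑ x ∈ T, koszulSign k x (T.erase x) •
    (c (T.erase x)).mapRange (contractVariable x T) (contractVariable_zero x T)

/-- The sum over `T` collapses: in the multidegree `m + indicatorExponent T` only the chosen
variable is moved from the polynomial into the exterior factor. -/
theorem coeff_koszulHomotopy (c : Finset V → B →₀ MvPolynomial V k) {T : Finset V} {b : B}
    {m : V →₀ ℕ} {x : V} (hx : chosenVariable (m + indicatorExponent T) = some x) :
    coeff m (koszulHomotopy c T b) = if x ∈ T then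
      koszulSign k x (T.erase x) * coeff (m + Finsupp.single x 1) (c (T.erase x) b) else 0 := by
  rw [koszulHomotopy, Finsupp.finsetSum_apply, coeff_sum]
  have h : ∀ y ∈ T, coeff m ((koszulSign k y (T.erase y) •
      (c (T.erase y)).mapRange (contractVariable y T) (contractVariable_zero y T)) b) =
      if x = y then koszulSign k y (T.erase y) *
        coeff (m + Finsupp.single y 1) (c (T.erase y) b) else 0 := by
    intro y _
    rw [Finsupp.smul_apply, coeff_smul, Finsupp.mapRange_apply, coeff_contractVariable, hx,
      smul_eq_mul]
    simp only [Option.some.injEq]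
    split_ifs <;> simp
  rw [Finset.sum_congr rfl h, Finset.sum_ite_eq]

theorem koszulHomotopy_mem_koszulPart {deg : B → ℤ} {q : ℕ} {j : ℤ}
    {c : Finset V → B →₀ MvPolynomial V k} (hc : c ∈ koszulPart k deg q j) :
    koszulHomotopy c ∈ koszulPart k deg (q + 1) j := by
  intro T b m h
  by_cases h0 : m + indicatorExponent T = 0
  · have hT : T = ∅ := by
      have h1 := congrArg Finsupp.degree h0
      rw [map_add, degree_indicatorExponent, map_zero] at h1
      simpa using (Nat.add_eq_zero_iff.1 h1).2
    simp [koszulHomotopy, hT] at h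
  · obtain ⟨x, hx⟩ := exists_chosenVariable h0
    rw [coeff_koszulHomotopy c hx] at h
    split_ifs at h with hxT
    · obtain ⟨h1, h2⟩ := hc _ b _ (right_ne_zero_of_mul h)
      rw [map_add, Finsupp.degree_single] at h2
      have := Finset.card_erase_add_one hxT
      push_cast at h2 ⊢
      exact ⟨by omega, by omega⟩
    · exact absurd rfl h

theorem coeff_koszulD (c : Finset V → B →₀ MvPolynomial V k) (T : Finset V) (b : B)
    (m : V →₀ ℕ) :
    coeff m (koszulD k _ c T b) =
      ∑ x ∈ Tᶜ, if m x ≠ 0 then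
        koszulSign k x T * coeff (m - Finsupp.single x 1) (c (insert x T) b) else 0 := by
  rw [koszulD_apply, Finsupp.finsetSum_apply, coeff_sum]
  refine Finset.sum_congr rfl fun x _ => ?_
  rw [Finsupp.smul_apply, smul_eq_mul, coeff_monomial_mul']
  simp only [Finsupp.single_le_iff, Nat.one_le_iff_ne_zero]

theorem koszulD_mem_koszulPart {deg : B → ℤ} {q : ℕ} {j : ℤ}
    {c : Finset V → B →₀ MvPolynomial V k} (hc : c ∈ koszulPart k deg (q + 1) j) :
    koszulD k _ c ∈ koszulPart k deg q j := by
  intro T b m h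
  rw [coeff_koszulD] at h
  obtain ⟨x, hx, hne⟩ := Finset.exists_ne_zero_of_sum_ne_zero h
  split_ifs at hne with hm
  · obtain ⟨h1, h2⟩ := hc _ b _ (right_ne_zero_of_mul hne)
    rw [Finset.card_insert_of_notMem (Finset.mem_compl.1 hx)] at h1
    have h3 : m.degree = (m - Finsupp.single x 1).degree + 1 := by
      conv_lhs => rw [← tsub_add_cancel_of_le
        (Finsupp.single_le_iff.2 (Nat.one_le_iff_ne_zero.2 hm))]
      rw [map_add, Finsupp.degree_single]
    rw [h3]
    push_cast at h2 ⊢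
    exact ⟨by omega, by omega⟩
  · exact absurd rfl hne

/-- In a nonzero multidegree the homotopy `h` divides by one fixed variable `x` and wedges with
`e_x`, so `dh + hd` is the identity there, in every characteristic; on a cycle this leaves `dh`. The
choice of `x` is consistent because the differential preserves multidegrees. In multidegree zero
only the constant coefficient of `e_∅` lives, and `h0` kills it. -/
theorem koszulD_koszulHomotopy {c : Finset V → B →₀ MvPolynomial V k}
    (hc : koszulD k _ c = 0) (h0 : ∀ b, coeff 0 (c ∅ b) = 0) :
    koszulD k _ (koszulHomotopy c) = c := by
  ext1 T
  refine finsupp_mvPolynomial_ext fun b m => ?_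
  rw [coeff_koszulD]
  have hexp : ∀ y ∈ Tᶜ, m y ≠ 0 →
      m - Finsupp.single y 1 + indicatorExponent (insert y T) = m + indicatorExponent T := by
    intro y hy hm
    rw [indicatorExponent_insert (Finset.mem_compl.1 hy), ← add_assoc,
      tsub_add_cancel_of_le (Finsupp.single_le_iff.2 (Nat.one_le_iff_ne_zero.2 hm))]
  by_cases hz : m + indicatorExponent T = 0
  · have h1 := congrArg Finsupp.degree hz
    rw [map_add, degree_indicatorExponent] at h1
    simp only [map_zero, Nat.add_eq_zero_iff, Finsupp.degree_eq_zero_iff,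
      Finset.card_eq_zero] at h1
    obtain ⟨rfl, rfl⟩ := h1
    rw [h0]
    simp
  · obtain ⟨x, hx⟩ := exists_chosenVariable hz
    have hmx := ne_zero_of_chosenVariable hx
    rw [Finsupp.add_apply, indicatorExponent_apply] at hmx
    have hsum : ∀ y ∈ Tᶜ, (if m y ≠ 0 then koszulSign k y T *
        coeff (m - Finsupp.single y 1) (koszulHomotopy c (insert y T) b) else 0) =
        if m y ≠ 0 then koszulSign k y T * (if x ∈ insert y T then
          koszulSign k x ((insert y T).erase x) *
            coeff (m - Finsupp.single y 1 + Finsupp.single x 1) (c ((insert y T).erase x) b)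
          else 0) else 0 := by
      intro y hy
      split_ifs with hm hxy
      · rw [coeff_koszulHomotopy c (by rw [hexp y hy hm]; exact hx), if_pos hxy]
      · rw [coeff_koszulHomotopy c (by rw [hexp y hy hm]; exact hx), if_neg hxy]
      · rfl
    rw [Finset.sum_congr rfl hsum]
    by_cases hxT : x ∈ T
    · have hd : coeff (m + Finsupp.single x 1) (koszulD k _ c (T.erase x) b) = 0 := by
        rw [hc]
        simp
      rw [coeff_koszulD, Finset.compl_erase,
        Finset.sum_insert (by simpa using hxT), if_pos (by simp), Finset.insert_erase hxT,
        add_tsub_cancel_right] at hd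
      have hrest : ∀ y ∈ Tᶜ, (if m y ≠ 0 then koszulSign k y T * (if x ∈ insert y T then
          koszulSign k x ((insert y T).erase x) *
            coeff (m - Finsupp.single y 1 + Finsupp.single x 1) (c ((insert y T).erase x) b)
          else 0) else 0) = -koszulSign k x (T.erase x) *
          (if (m + Finsupp.single x 1 : V →₀ ℕ) y ≠ 0 then koszulSign k y (T.erase x) *
            coeff (m + Finsupp.single x 1 - Finsupp.single y 1) (c (insert y (T.erase x)) b)
            else 0) := by
        intro y hy
        have hyT := Finset.mem_compl.1 hy
        have hyx : y ≠ x := fun h => hyT (h ▸ hxT)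
        have h1 : (m + Finsupp.single x 1 : V →₀ ℕ) y = m y := by
          simp [Finsupp.single_eq_of_ne hyx]
        rw [h1, if_pos (Finset.mem_insert_of_mem hxT)]
        split_ifs with hm
        · have h2 : (insert y T).erase x = insert y (T.erase x) :=
            Finset.erase_insert_of_ne hyx
          have h3 : m - Finsupp.single y 1 + Finsupp.single x 1 =
              m + Finsupp.single x 1 - Finsupp.single y 1 :=
            tsub_add_eq_add_tsub (Finsupp.single_le_iff.2 (Nat.one_le_iff_ne_zero.2 hm))
          have h4 := koszulSign_swap (k := k) (T := T.erase x) hyx (by simp [hyT]) (by simp)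
          rw [Finset.insert_erase hxT] at h4
          have h5 := koszulSign_mul_self (k := k) x (T.erase x)
          have h6 := koszulSign_mul_self (k := k) x (insert y (T.erase x))
          rw [h2, h3, ← mul_assoc]
          set s := coeff (m + Finsupp.single x 1 - Finsupp.single y 1)
            (c (insert y (T.erase x)) b)
          linear_combination (koszulSign k x (insert y (T.erase x)) * koszulSign k x (T.erase x) *
            s) * h4 - koszulSign k y (T.erase x) * koszulSign k x (T.erase x) * s * h6 -
            koszulSign k x (insert y (T.erase x)) * koszulSign k y T * s * h5
        · simp
      rw [Finset.sum_congr rfl hrest, ← Finset.mul_sum]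
      linear_combination (-koszulSign k x (T.erase x)) * hd +
        coeff m (c T b) * koszulSign_mul_self (k := k) x (T.erase x)
    · rw [if_neg hxT, add_zero] at hmx
      -- For `x ∉ T` only the summand `x` survives, since the homotopy has values in this
      -- multidegree only on sets that contain `x`.
      rw [Finset.sum_eq_single x]
      · rw [if_pos hmx, if_pos (Finset.mem_insert_self _ _), Finset.erase_insert hxT, ← mul_assoc,
          koszulSign_mul_self, one_mul, tsub_add_cancel_of_le
          (Finsupp.single_le_iff.2 (Nat.one_le_iff_ne_zero.2 hmx))]
      · intro y _ hyx
        have : x ∉ insert y T := by simp [hxT, Ne.symm hyx]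
        simp [this]
      · intro h
        simp [hxT] at h

end KoszulExact

/-- Both ranges are the quotient of `M` by the common kernel. With the two projections of a linear
relation as `f` and `g`, this turns the relation into an isomorphism. -/
theorem nonempty_range_equiv_of_ker_eq {K M N P : Type*} [Field K] [AddCommGroup M]
    [AddCommGroup N] [AddCommGroup P] [Module K M] [Module K N] [Module K P] {f : M →ₗ[K] N}
    {g : M →ₗ[K] P} (h : LinearMap.ker f = LinearMap.ker g) :
    Nonempty (LinearMap.range f ≃ₗ[K] LinearMap.range g) :=
  ⟨f.quotKerEquivRange.symm.trans
    ((Submodule.quotEquivOfEq _ _ h).trans g.quotKerEquivRange)⟩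

section KoszulExactGraded

open MvPolynomial

variable {k : Type u} [Field k] {V : Type v} {B : Type w}

/-- The augmentation of the Koszul complex: the constant terms of the coefficient of `e_∅`. -/
noncomputable def koszulAug (k : Type u) [Field k] (V : Type v) (B : Type w) :
    (Finset V → B →₀ MvPolynomial V k) →ₗ[k] (B →₀ k) where
  toFun c := Finsupp.mapRange constantCoeff (map_zero _) (c ∅)
  map_add' c c' := by
    ext b
    simp
  map_smul' r c := by
    ext b
    simp

theorem koszulAug_apply (c : Finset V → B →₀ MvPolynomial V k) (b : B) :
    koszulAug k V B c b = coeff 0 (c ∅ b) := rfl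

variable [Fintype V] [DecidableEq V]

theorem exists_koszulD_eq {deg : B → ℤ} {q : ℕ} {j : ℤ} {c : Finset V → B →₀ MvPolynomial V k}
    (hc : c ∈ koszulPart k deg q j) (hd : koszulD k _ c = 0) (h0 : ∀ b, coeff 0 (c ∅ b) = 0) :
    ∃ y ∈ koszulPart k deg (q + 1) j, koszulD k _ y = c :=
  ⟨_, koszulHomotopy_mem_koszulPart hc, koszulD_koszulHomotopy hd h0⟩

theorem exists_koszulD_eq_succ {deg : B → ℤ} {q : ℕ} {j : ℤ}
    {c : Finset V → B →₀ MvPolynomial V k} (hc : c ∈ koszulPart k deg (q + 1) j)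
    (hd : koszulD k _ c = 0) : ∃ y ∈ koszulPart k deg (q + 1 + 1) j, koszulD k _ y = c :=
  exists_koszulD_eq hc hd fun b => by
    rw [apply_eq_zero_of_mem_koszulPart hc (by simp)]
    simp

theorem koszulAug_koszulD (c : Finset V → B →₀ MvPolynomial V k) :
    koszulAug k V B (koszulD k _ c) = 0 := by
  ext b
  rw [koszulAug_apply, coeff_koszulD]
  simp

/-- In exterior degree zero every chain is a cycle, and the vanishing constant terms are the only
obstruction to being a boundary. -/
theorem exists_koszulD_eq_of_koszulAug {deg : B → ℤ} {j : ℤ}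
    {c : Finset V → B →₀ MvPolynomial V k} (hc : c ∈ koszulPart k deg 0 j)
    (h0 : koszulAug k V B c = 0) : ∃ y ∈ koszulPart k deg (0 + 1) j, koszulD k _ y = c := by
  refine exists_koszulD_eq hc ?_ fun b => by rw [← koszulAug_apply, h0, Finsupp.zero_apply]
  ext1 T
  rw [koszulD_apply]
  refine Finset.sum_eq_zero fun x hx => ?_
  rw [apply_eq_zero_of_mem_koszulPart hc, smul_zero]
  rw [Finset.card_insert_of_notMem (Finset.mem_compl.1 hx)]
  exact Nat.succ_ne_zero _

end KoszulExactGraded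

/-! ### The double complex of a resolution and the Koszul complex, and the balancing of Tor. -/

namespace GradedFreeResolution

open MvPolynomial

variable {k : Type u} [Field k] {V : Type v}
  {I : Ideal (MvPolynomial V k)} (F : GradedFreeResolution.{u, v, w} I)

theorem mapRange_d (i : ℕ) (f : F.B (i + 1) →₀ MvPolynomial V k) :
    Finsupp.mapRange constantCoeff (map_zero _) (F.d i f) =
      F.tensorD i (Finsupp.mapRange constantCoeff (map_zero _) f) := by
  induction f using Finsupp.induction_linear with
  | zero => simp
  | add f g hf hg =>
    rw [map_add, Finsupp.mapRange_add (map_add _), hf, hg, Finsupp.mapRange_add (map_add _),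
      map_add]
  | single b p =>
    have h1 : Finsupp.single b p = p • Finsupp.single b (1 : MvPolynomial V k) := by
      rw [Finsupp.smul_single, smul_eq_mul, mul_one]
    rw [Finsupp.mapRange_single, tensorD, Finsupp.linearCombination_single, h1, map_smul]
    ext b'
    simp

/-- The augmentation, with values in the free module of rank one. -/
noncomputable def augUnit : (F.B 0 →₀ MvPolynomial V k) →ₗ[MvPolynomial V k]
    (Unit →₀ MvPolynomial V k) :=
  Finsupp.lsingle () ∘ₗ F.aug

theorem augUnit_apply (f : F.B 0 →₀ MvPolynomial V k) (b : Unit) : F.augUnit f b = F.aug f := by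
  simp [augUnit]

theorem augUnit_mem (f : F.B 0 →₀ MvPolynomial V k) (b : Unit) : F.augUnit f b ∈ I := by
  have h : F.aug f ∈ LinearMap.range F.aug := LinearMap.mem_range_self _ _
  rwa [F.range_aug, ← F.augUnit_apply f b] at h

theorem augUnit_homogeneous (b : F.B 0) :
    IsHomogeneousVec (fun _ => 0) (F.augUnit (Finsupp.single b 1)) (F.deg 0 b) := by
  intro b' m hm
  rw [augUnit_apply] at hm
  rw [zero_add, F.aug_homogeneous b m hm]

theorem augUnit_d (f : F.B 1 →₀ MvPolynomial V k) : F.augUnit (F.d 0 f) = 0 := by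
  have h : F.d 0 f ∈ LinearMap.ker F.aug := F.exact_zero ▸ LinearMap.mem_range_self _ _
  rw [augUnit, LinearMap.comp_apply, LinearMap.mem_ker.1 h, map_zero]

theorem d_d (i : ℕ) (f : F.B (i + 2) →₀ MvPolynomial V k) : F.d i (F.d (i + 1) f) = 0 := by
  have h : F.d (i + 1) f ∈ LinearMap.ker (F.d i) := F.exact_succ i ▸ LinearMap.mem_range_self _ _
  exact h

theorem mem_range_d_zero {f : F.B 0 →₀ MvPolynomial V k} (h : F.augUnit f = 0) :
    f ∈ LinearMap.range (F.d 0) := by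
  rw [← F.exact_zero, LinearMap.mem_ker, ← F.augUnit_apply f (), h, Finsupp.zero_apply]

theorem mem_range_d_succ {i : ℕ} {f : F.B (i + 1) →₀ MvPolynomial V k} (h : F.d i f = 0) :
    f ∈ LinearMap.range (F.d (i + 1)) := by
  rwa [← F.exact_succ, LinearMap.mem_ker]

/-- The chains of the double complex of a resolution and the Koszul complex. -/
abbrev DoubleChain (p : ℕ) : Type _ := Finset V → F.B p →₀ MvPolynomial V k

/-- The differential of the double complex that comes from the resolution. -/
noncomputable def chainD (p : ℕ) :
    F.DoubleChain (p + 1) →ₗ[MvPolynomial V k] F.DoubleChain p :=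
  (F.d p).compLeft (Finset V)

/-- The augmentation of the double complex that comes from the resolution. -/
noncomputable def chainAug :
    F.DoubleChain 0 →ₗ[MvPolynomial V k] (Finset V → Unit →₀ MvPolynomial V k) :=
  F.augUnit.compLeft (Finset V)

theorem chainD_chainD (p : ℕ) (x : F.DoubleChain (p + 2)) :
    F.chainD p (F.chainD (p + 1) x) = 0 :=
  funext fun T => F.d_d p (x T)

theorem chainAug_chainD (x : F.DoubleChain 1) : F.chainAug (F.chainD 0 x) = 0 :=
  funext fun T => F.augUnit_d (x T)

theorem chainD_mem {p q : ℕ} {j : ℤ} {x : F.DoubleChain (p + 1)}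
    (hx : x ∈ koszulPart k (F.deg (p + 1)) q j) : F.chainD p x ∈ koszulPart k (F.deg p) q j :=
  map_mem_koszulPart _ (F.d_homogeneous p) hx

theorem chainAug_mem {q : ℕ} {j : ℤ} {x : F.DoubleChain 0}
    (hx : x ∈ koszulPart k (F.deg 0) q j) :
    F.chainAug x ∈ koszulPart k (fun _ => 0) q j :=
  map_mem_koszulPart _ F.augUnit_homogeneous hx

theorem exists_chainD_eq {p q : ℕ} {j : ℤ} {x : F.DoubleChain p}
    (hx : x ∈ koszulPart k (F.deg p) q j) (hr : ∀ T, x T ∈ LinearMap.range (F.d p)) :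
    ∃ y ∈ koszulPart k (F.deg (p + 1)) q j, F.chainD p y = x :=
  exists_preimage_mem_koszulPart _ (F.d_homogeneous p) hx hr

theorem exists_chainD_eq_of_chainD {p q : ℕ} {j : ℤ} {x : F.DoubleChain (p + 1)}
    (hx : x ∈ koszulPart k (F.deg (p + 1)) q j) (h : F.chainD p x = 0) :
    ∃ y ∈ koszulPart k (F.deg (p + 2)) q j, F.chainD (p + 1) y = x :=
  F.exists_chainD_eq hx fun T => F.mem_range_d_succ (congrFun h T)

theorem koszulAug_chainD (p : ℕ) (x : F.DoubleChain (p + 1)) :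
    koszulAug k V _ (F.chainD p x) = F.tensorD p (koszulAug k V _ x) :=
  F.mapRange_d p (x ∅)

theorem koszulAug_mem_tensorPart {p : ℕ} {j : ℤ} {x : F.DoubleChain p}
    (hx : x ∈ koszulPart k (F.deg p) 0 j) : koszulAug k V _ x ∈ F.tensorPart p j := by
  rw [tensorPart, Finsupp.mem_supported]
  intro b hb
  have hb' : koszulAug k V _ x b ≠ 0 := Finsupp.mem_support_iff.1 hb
  have := (hx ∅ b 0 hb').2
  simpa using this

theorem exists_koszulAug_eq {p : ℕ} {j : ℤ} {t : F.B p →₀ k} (ht : t ∈ F.tensorPart p j) :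
    ∃ x ∈ koszulPart k (F.deg p) 0 j, koszulAug k V _ x = t := by
  classical
  refine ⟨fun T => if T = ∅ then t.mapRange C (map_zero _) else 0, ?_, ?_⟩
  · intro T b m h
    beta_reduce at h
    split_ifs at h with hT
    · rw [Finsupp.mapRange_apply, coeff_C] at h
      split_ifs at h with hm
      · have hb : F.deg p b = j := (Finsupp.mem_supported _ _).1 ht (Finsupp.mem_support_iff.2 h)
        subst hT hm
        simpa using hb
      · exact absurd rfl h
    · simp at h
  · ext b
    rw [koszulAug_apply, if_pos rfl, Finsupp.mapRange_apply, coeff_zero_C]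

variable [Fintype V] [DecidableEq V]

theorem koszulD_chainD (p : ℕ) (x : F.DoubleChain (p + 1)) :
    koszulD k _ (F.chainD p x) = F.chainD p (koszulD k _ x) :=
  koszulD_comp_map (F.d p) x

theorem koszulD_chainAug (x : F.DoubleChain 0) :
    koszulD k _ (F.chainAug x) = F.chainAug (koszulD k _ x) :=
  koszulD_comp_map F.augUnit x

/-- One more step of a staircase in the double complex. -/
noncomputable def staircaseStep (j : ℤ) (p q : ℕ)
    (S : Submodule k (F.DoubleChain p × (Finset V → Unit →₀ MvPolynomial V k))) :
    Submodule k (F.DoubleChain (p + 1) × (Finset V → Unit →₀ MvPolynomial V k)) :=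
  ((koszulPart k (F.deg (p + 1)) q j).comap (LinearMap.fst k _ _) ⊓ S.comap (LinearMap.snd k _ _) ⊓
    LinearMap.eqLocus ((F.chainD p).restrictScalars k ∘ₗ LinearMap.fst k _ _)
      ((koszulD k _).restrictScalars k ∘ₗ LinearMap.fst k _ _ ∘ₗ LinearMap.snd k _ _)).map
    (LinearMap.id.prodMap (LinearMap.snd k _ _))

theorem mem_staircaseStep {j : ℤ} {p q : ℕ}
    {S : Submodule k (F.DoubleChain p × (Finset V → Unit →₀ MvPolynomial V k))}
    {x : F.DoubleChain (p + 1)} {z : Finset V → Unit →₀ MvPolynomial V k} :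
    (x, z) ∈ F.staircaseStep j p q S ↔ x ∈ koszulPart k (F.deg (p + 1)) q j ∧
      ∃ y, (y, z) ∈ S ∧ F.chainD p x = koszulD k _ y := by
  constructor
  · rintro ⟨⟨x', y, z'⟩, ⟨⟨h1, h2⟩, h3⟩, h⟩
    obtain ⟨rfl, rfl⟩ := Prod.ext_iff.1 h
    exact ⟨h1, y, h2, h3⟩
  · rintro ⟨h1, y, h2, h3⟩
    exact ⟨(x, y, z), ⟨⟨h1, h2⟩, h3⟩, rfl⟩

/-- The pairs of a chain `x` in `F_p ⊗ Λ^q` and a chain `z` in `I ⊗ Λ^(p + q)` that are the ends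
of a staircase in the double complex. -/
noncomputable def staircase (j : ℤ) :
    (p q : ℕ) → Submodule k (F.DoubleChain p × (Finset V → Unit →₀ MvPolynomial V k))
  | 0, q => (koszulPart k (F.deg 0) q j).comap (LinearMap.fst k _ _) ⊓
      LinearMap.eqLocus (F.chainAug.restrictScalars k ∘ₗ LinearMap.fst k _ _) (LinearMap.snd k _ _)
  | p + 1, q => F.staircaseStep j p q (staircase j p (q + 1))

theorem mem_staircase_zero {j : ℤ} {q : ℕ} {x : F.DoubleChain 0}
    {z : Finset V → Unit →₀ MvPolynomial V k} :
    (x, z) ∈ F.staircase j 0 q ↔ x ∈ koszulPart k (F.deg 0) q j ∧ F.chainAug x = z :=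
  Iff.rfl

theorem mem_staircase_succ {j : ℤ} {p q : ℕ} {x : F.DoubleChain (p + 1)}
    {z : Finset V → Unit →₀ MvPolynomial V k} :
    (x, z) ∈ F.staircase j (p + 1) q ↔ x ∈ koszulPart k (F.deg (p + 1)) q j ∧
      ∃ y, (y, z) ∈ F.staircase j p (q + 1) ∧ F.chainD p x = koszulD k _ y :=
  F.mem_staircaseStep

theorem mem_koszulPart_of_mem_staircase {j : ℤ} {p q : ℕ} {x : F.DoubleChain p}
    {z : Finset V → Unit →₀ MvPolynomial V k} (h : (x, z) ∈ F.staircase j p q) :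
    x ∈ koszulPart k (F.deg p) q j := by
  cases p with
  | zero => exact (F.mem_staircase_zero.1 h).1
  | succ p => exact (F.mem_staircase_succ.1 h).1

/-- The cycles of the Koszul complex with coefficients in the ideal `I`, of exterior degree `q` and
total degree `j`. -/
noncomputable def koszulCycles (I : Ideal (MvPolynomial V k)) (q : ℕ) (j : ℤ) :
    Submodule k (Finset V → Unit →₀ MvPolynomial V k) where
  carrier := {z | z ∈ koszulPart k (fun _ => 0) q j ∧ (∀ T, z T () ∈ I) ∧ koszulD k _ z = 0}
  zero_mem' := ⟨Submodule.zero_mem _, by simp, map_zero _⟩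
  add_mem' ha hb := ⟨Submodule.add_mem _ ha.1 hb.1, fun T => I.add_mem (ha.2.1 T) (hb.2.1 T), by
    rw [map_add, ha.2.2, hb.2.2, add_zero]⟩
  smul_mem' r a ha := ⟨Submodule.smul_mem _ r ha.1,
    fun T => Submodule.smul_of_tower_mem I r (ha.2.1 T), by
    rw [LinearMap.map_smul_of_tower, ha.2.2, smul_zero]⟩

/-- By induction the previous chain `y` of the staircase is already a sum of two boundaries; its
resolution part corrects `x` to a cycle for `F.d`, and exactness of `F` finishes. Thus a staircase
that ends in zero gives the zero class in Tor. -/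
theorem exists_of_mem_staircase_zero {j : ℤ} {p q : ℕ} {x : F.DoubleChain p}
    (h : (x, 0) ∈ F.staircase j p q) :
    ∃ y ∈ koszulPart k (F.deg p) (q + 1) j, ∃ u ∈ koszulPart k (F.deg (p + 1)) q j,
      x = koszulD k _ y + F.chainD p u := by
  induction p generalizing q with
  | zero =>
    obtain ⟨hx, h0⟩ := F.mem_staircase_zero.1 h
    obtain ⟨u, hu, rfl⟩ := F.exists_chainD_eq hx fun T => F.mem_range_d_zero (congrFun h0 T)
    exact ⟨0, Submodule.zero_mem _, u, hu, by simp⟩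
  | succ p ih =>
    obtain ⟨hx, y, hy, hxy⟩ := F.mem_staircase_succ.1 h
    obtain ⟨y', hy', u', hu', rfl⟩ := ih hy
    rw [map_add, koszulD_koszulD, zero_add, koszulD_chainD, ← sub_eq_zero, ← map_sub] at hxy
    obtain ⟨u, hu, hux⟩ := F.exists_chainD_eq_of_chainD
      (Submodule.sub_mem _ hx (koszulD_mem_koszulPart hu')) hxy
    exact ⟨u', hu', u, hu, by rw [hux]; abel⟩

variable {i : ℕ} {j : ℤ}

/-- The converse chase uses exactness of the Koszul columns to carry the boundary form down the
staircase. At the bottom, `z` is the Koszul boundary of a chain in `I ⊗ Λ^(i+1)`, which is zero by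
`hI`. -/
theorem staircase_eq_zero
    (hI : ∀ z ∈ koszulPart k (fun _ : Unit => 0) (i + 1) j, (∀ T, z T () ∈ I) → z = 0)
    {p q : ℕ} (hpq : p + q = i) {y : F.DoubleChain p} {u : F.DoubleChain (p + 1)}
    {z : Finset V → Unit →₀ MvPolynomial V k} (hy : y ∈ koszulPart k (F.deg p) (q + 1) j)
    (h : (koszulD k _ y + F.chainD p u, z) ∈ F.staircase j p q) : z = 0 := by
  induction p generalizing q with
  | zero =>
    obtain ⟨-, h0⟩ := F.mem_staircase_zero.1 h
    rw [map_add, chainAug_chainD, add_zero, ← koszulD_chainAug] at h0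
    rw [zero_add] at hpq
    subst hpq
    rw [hI _ (F.chainAug_mem hy), map_zero] at h0
    · exact h0.symm
    · exact fun T => F.augUnit_mem _ _
  | succ p ih =>
    obtain ⟨-, y', hy', hyy⟩ := F.mem_staircase_succ.1 h
    rw [map_add, chainD_chainD, add_zero, ← koszulD_chainD] at hyy
    have hy1 := F.mem_koszulPart_of_mem_staircase hy'
    obtain ⟨y'', hy'', he⟩ := exists_koszulD_eq_succ
      (Submodule.sub_mem _ hy1 (F.chainD_mem hy)) (by rw [map_sub, hyy, sub_self])
    refine ih (q := q + 1) (by omega) hy'' (u := y) ?_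
    rwa [he, sub_add_cancel]

theorem koszulD_mem_range_of_mem_staircase {p q : ℕ} {x : F.DoubleChain p}
    {z : Finset V → Unit →₀ MvPolynomial V k} (h : (x, z) ∈ F.staircase j p q)
    (hz : koszulD k _ z = 0) (T : Finset V) : koszulD k _ x T ∈ LinearMap.range (F.d p) := by
  cases p with
  | zero =>
    obtain ⟨-, rfl⟩ := F.mem_staircase_zero.1 h
    rw [koszulD_chainAug] at hz
    exact F.mem_range_d_zero (congrFun hz T)
  | succ p =>
    obtain ⟨-, y, -, hxy⟩ := F.mem_staircase_succ.1 h
    have h0 : F.chainD p (koszulD k _ x) = 0 := by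
      rw [← koszulD_chainD, hxy, koszulD_koszulD]
    exact F.mem_range_d_succ (congrFun h0 T)

/-- Starting from a Koszul cycle, exactness of `F` supplies the lifts, so every cycle is hit by the
correspondence. -/
theorem exists_mem_staircase {z : Finset V → Unit →₀ MvPolynomial V k}
    (hz : z ∈ koszulCycles I i j) {p q : ℕ} (hpq : p + q = i) :
    ∃ x, (x, z) ∈ F.staircase j p q := by
  induction p generalizing q with
  | zero =>
    rw [zero_add] at hpq
    subst hpq
    obtain ⟨x, hx, hxz⟩ := exists_preimage_mem_koszulPart F.augUnit F.augUnit_homogeneous hz.1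
      fun T => by
        have hT := hz.2.1 T
        rw [← F.range_aug] at hT
        obtain ⟨f, hf⟩ := hT
        exact ⟨f, Finsupp.ext fun b => by rw [augUnit_apply, hf]⟩
    exact ⟨x, F.mem_staircase_zero.2 ⟨hx, hxz⟩⟩
  | succ p ih =>
    obtain ⟨y, hy⟩ := ih (q := q + 1) (by omega)
    obtain ⟨x, hx, hxy⟩ := F.exists_chainD_eq
      (koszulD_mem_koszulPart (F.mem_koszulPart_of_mem_staircase hy))
      (F.koszulD_mem_range_of_mem_staircase hy hz.2.2)
    exact ⟨x, F.mem_staircase_succ.2 ⟨hx, y, hy, hxy⟩⟩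

/-- The chase from the Tor side uses Koszul exactness instead. The exterior degree stays positive,
so the Koszul augmentation puts no condition on the chains. -/
theorem exists_mem_staircase_left {p q : ℕ} (hpq : p + (q + 1) = i) {x : F.DoubleChain p}
    (hx : x ∈ koszulPart k (F.deg p) (q + 1) j)
    (hr : ∀ T, koszulD k _ x T ∈ LinearMap.range (F.d p)) :
    ∃ z ∈ koszulCycles I i j, (x, z) ∈ F.staircase j p (q + 1) := by
  induction p generalizing q with
  | zero =>
    rw [zero_add] at hpq
    subst hpq
    refine ⟨F.chainAug x, ⟨F.chainAug_mem hx, fun T => F.augUnit_mem _ _, ?_⟩,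
      F.mem_staircase_zero.2 ⟨hx, rfl⟩⟩
    rw [koszulD_chainAug]
    ext1 T
    obtain ⟨f, hf⟩ := hr T
    rw [chainAug, LinearMap.compLeft_apply, Function.comp_apply, ← hf, augUnit_d, Pi.zero_apply]
  | succ p ih =>
    have h0 : koszulD k _ (F.chainD p x) = 0 := by
      rw [koszulD_chainD]
      ext1 T
      obtain ⟨f, hf⟩ := hr T
      rw [chainD, LinearMap.compLeft_apply, Function.comp_apply, ← hf, d_d, Pi.zero_apply]
    obtain ⟨y, hy, hyx⟩ := exists_koszulD_eq_succ (F.chainD_mem hx) h0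
    obtain ⟨z, hz, hyz⟩ := ih (q := q + 1) (by omega) hy fun T => by
      rw [hyx]
      exact LinearMap.mem_range_self _ _
    exact ⟨z, hz, F.mem_staircase_succ.2 ⟨hx, y, hyz, hyx.symm⟩⟩

/-- If `I ⊗ Λ^(i + 1)` vanishes in degree `j`, then `Tor_i(I, k)_j` is the space of cycles of the
Koszul complex with coefficients in `I`. -/
theorem nonempty_tor_equiv_koszulCycles
    (hI : ∀ z ∈ koszulPart k (fun _ : Unit => 0) (i + 1 + 1) j, (∀ T, z T () ∈ I) → z = 0) :
    Nonempty (F.Tor (i + 1) j ≃ₗ[k] koszulCycles I (i + 1) j) := by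
  -- The staircases form a linear relation between Tor and the Koszul cycles. It projects onto both
  -- sides, with equal kernels.
  set Γ : Submodule k (F.DoubleChain (i + 1) × (Finset V → Unit →₀ MvPolynomial V k)) :=
    F.staircase j (i + 1) 0 ⊓ (koszulCycles I (i + 1) j).comap (LinearMap.snd k _ _)
  set f : Γ →ₗ[k] ((F.B (i + 1) →₀ k) ⧸ F.boundaries (i + 1) j) :=
    (F.boundaries (i + 1) j).mkQ ∘ₗ koszulAug k V _ ∘ₗ LinearMap.fst k _ _ ∘ₗ Γ.subtype
  set g : Γ →ₗ[k] (Finset V → Unit →₀ MvPolynomial V k) :=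
    LinearMap.snd k _ _ ∘ₗ Γ.subtype
  have hrf : LinearMap.range f = F.Tor (i + 1) j := by
    refine le_antisymm ?_ ?_
    · rintro _ ⟨⟨⟨x, z⟩, hxz, hz⟩, rfl⟩
      obtain ⟨hx, y, -, hxy⟩ := F.mem_staircase_succ.1 hxz
      refine Submodule.mem_map_of_mem ⟨F.koszulAug_mem_tensorPart hx, ?_⟩
      change F.tensorD i (koszulAug k V _ x) = 0
      rw [← koszulAug_chainD, hxy, koszulAug_koszulD]
    · rintro _ ⟨t, ⟨ht, ht0⟩, rfl⟩
      obtain ⟨x, hx, rfl⟩ := F.exists_koszulAug_eq ht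
      have ht1 : F.tensorD i (koszulAug k V _ x) = 0 := ht0
      rw [← koszulAug_chainD] at ht1
      obtain ⟨y, hy, hyx⟩ := exists_koszulD_eq_of_koszulAug (F.chainD_mem hx) ht1
      obtain ⟨z, hz, hyz⟩ := F.exists_mem_staircase_left (i := i + 1) rfl hy fun T => by
        rw [hyx]
        exact LinearMap.mem_range_self _ _
      exact ⟨⟨(x, z), F.mem_staircase_succ.2 ⟨hx, y, hyz, hyx.symm⟩, hz⟩, rfl⟩
  have hrg : LinearMap.range g = koszulCycles I (i + 1) j := by
    refine le_antisymm ?_ ?_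
    · rintro _ ⟨⟨⟨x, z⟩, hxz, hz⟩, rfl⟩
      exact hz
    · intro z hz
      obtain ⟨x, hx⟩ := F.exists_mem_staircase hz (add_zero (i + 1))
      exact ⟨⟨(x, z), hx, hz⟩, rfl⟩
  have hker : LinearMap.ker f = LinearMap.ker g := by
    ext ⟨⟨x, z⟩, hxz, hz⟩
    have hfz : f ⟨(x, z), hxz, hz⟩ = (F.boundaries (i + 1) j).mkQ (koszulAug k V _ x) := rfl
    have hgz : g ⟨(x, z), hxz, hz⟩ = z := rfl
    rw [LinearMap.mem_ker, LinearMap.mem_ker, hfz, hgz, Submodule.mkQ_apply,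
      Submodule.Quotient.mk_eq_zero]
    have hx : x ∈ koszulPart k (F.deg (i + 1)) 0 j := F.mem_koszulPart_of_mem_staircase hxz
    constructor
    · rintro ⟨s, hs, hsx⟩
      obtain ⟨u, hu, rfl⟩ := F.exists_koszulAug_eq hs
      rw [← koszulAug_chainD] at hsx
      obtain ⟨y, hy, hyx⟩ := exists_koszulD_eq_of_koszulAug
        (Submodule.sub_mem _ hx (F.chainD_mem hu)) (by rw [map_sub, hsx, sub_self])
      refine F.staircase_eq_zero hI (add_zero (i + 1)) hy (u := u) ?_
      rw [hyx, sub_add_cancel]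
      exact hxz
    · rintro rfl
      obtain ⟨y, -, u, hu, rfl⟩ := F.exists_of_mem_staircase_zero hxz
      have h : koszulAug k V _ (koszulD k _ y + F.chainD (i + 1) u) =
          F.tensorD (i + 1) (koszulAug k V _ u) := by
        rw [(koszulAug k V _).map_add, koszulAug_koszulD, zero_add, koszulAug_chainD]
      rw [h]
      exact Submodule.mem_map_of_mem (F.koszulAug_mem_tensorPart hu)
  have hequiv : Nonempty (LinearMap.range f ≃ₗ[k] LinearMap.range g) :=
    nonempty_range_equiv_of_ker_eq (M := Γ) (N := (F.B (i + 1) →₀ k) ⧸ F.boundaries (i + 1) j)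
      (P := Finset V → Unit →₀ MvPolynomial V k) hker
  obtain ⟨e⟩ := hequiv
  exact ⟨(LinearEquiv.ofEq _ _ hrf).symm.trans (e.trans (LinearEquiv.ofEq _ _ hrg))⟩

end GradedFreeResolution

/-! ### Koszul cycles of an edge ideal as potentials on vertex sets. -/

section EdgeIdeal

open MvPolynomial GradedFreeResolution

variable {k : Type u} [Field k] {V : Type v}

theorem SimpleGraph.mem_edgeIdeal_iff {G : SimpleGraph V} {p : MvPolynomial V k} :
    p ∈ G.edgeIdeal k ↔ ∀ m, coeff m p ≠ 0 →
      ∃ a b, G.Adj a b ∧ Finsupp.single a 1 + Finsupp.single b 1 ≤ m := by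
  have h : {p : MvPolynomial V k | ∃ a b : V, G.Adj a b ∧ p = X a * X b} =
      (fun s => monomial s (1 : k)) ''
        {s | ∃ a b : V, G.Adj a b ∧ s = Finsupp.single a 1 + Finsupp.single b 1} := by
    ext p
    constructor
    · rintro ⟨a, b, hab, rfl⟩
      exact ⟨_, ⟨a, b, hab, rfl⟩, by simp [X, monomial_mul]⟩
    · rintro ⟨_, ⟨a, b, hab, rfl⟩, rfl⟩
      exact ⟨a, b, hab, by simp [X, monomial_mul]⟩
  rw [SimpleGraph.edgeIdeal, h, mem_ideal_span_monomial_image]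
  constructor
  · intro hp m hm
    obtain ⟨_, ⟨a, b, hab, rfl⟩, hle⟩ := hp m (MvPolynomial.mem_support_iff.2 hm)
    exact ⟨a, b, hab, hle⟩
  · intro hp m hm
    obtain ⟨a, b, hab, hle⟩ := hp m (MvPolynomial.mem_support_iff.1 hm)
    exact ⟨_, ⟨a, b, hab, rfl⟩, hle⟩

/-- Exterior degree `i + 1` in total degree `i + 2` leaves only linear coefficients, while the ideal
starts in degree two. -/
theorem SimpleGraph.eq_zero_of_mem_edgeIdeal {G : SimpleGraph V} {i : ℕ}
    {z : Finset V → Unit →₀ MvPolynomial V k}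
    (hz : z ∈ koszulPart k (fun _ : Unit => 0) (i + 1) (i + 2))
    (hI : ∀ T, z T () ∈ G.edgeIdeal k) : z = 0 := by
  ext1 T
  refine finsupp_mvPolynomial_ext fun b m => ?_
  by_contra hm
  rw [Pi.zero_apply, Finsupp.zero_apply, coeff_zero] at hm
  obtain ⟨a, b, -, hle⟩ := SimpleGraph.mem_edgeIdeal_iff.1 (hI T) m hm
  have h1 := (hz T () m hm).2
  have h2 := Finsupp.degree_mono hle
  rw [map_add, Finsupp.degree_single, Finsupp.degree_single] at h2
  push_cast at h1
  omega

theorem single_add_single_eq_iff {a b c d : V} :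
    (Finsupp.single a 1 + Finsupp.single b 1 : V →₀ ℕ) =
      Finsupp.single c 1 + Finsupp.single d 1 ↔ a = c ∧ b = d ∨ a = d ∧ b = c := by
  rw [Finsupp.single_add_single_eq_single_add_single one_ne_zero one_ne_zero]
  simp

theorem eq_of_le_of_degree_eq {m n : V →₀ ℕ} (h : m ≤ n) (hd : n.degree = m.degree) : m = n := by
  have h1 : n - m + m = n := tsub_add_cancel_of_le h
  have h2 : (n - m).degree = 0 := by
    have := congrArg Finsupp.degree h1
    rw [map_add] at this
    omega
  rw [Finsupp.degree_eq_zero_iff] at h2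
  rwa [h2, zero_add] at h1

variable [Fintype V] [DecidableEq V]

/-- The sign of `e_a ∧ e_b ∧ e_c ∧ e_T`. -/
noncomputable def tripleSign (k : Type u) [Field k] (T : Finset V) (a b c : V) : k :=
  koszulSign k c T * koszulSign k b (insert c T) * koszulSign k a (insert b (insert c T))

/-- A cyclic rotation of three factors is two transpositions. -/
theorem tripleSign_rotate {T : Finset V} {a b c : V} (hab : a ≠ b) (hbc : b ≠ c) (hac : a ≠ c)
    (ha : a ∉ T) (hb : b ∉ T) (hc : c ∉ T) : tripleSign k T b c a = tripleSign k T a b c := by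
  have h1 := koszulSign_swap (k := k) hac ha hc
  have h2 := koszulSign_swap (k := k) (T := insert c T) hab (by simp [hac, ha]) (by simp [hbc, hb])
  rw [tripleSign, tripleSign, Finset.insert_comm c a]
  linear_combination koszulSign k b (insert a (insert c T)) * h1 - koszulSign k c T * h2

/-- The coefficient of `x_a x_b ⊗ e_T`, divided by the sign of `e_a ∧ e_b ∧ e_T`. -/
noncomputable def edgeCoeff (z : Finset V → Unit →₀ MvPolynomial V k) (T : Finset V) (a b : V) :
    k :=
  koszulSign k b T * koszulSign k a (insert b T) *
    coeff (Finsupp.single a 1 + Finsupp.single b 1) (z T ())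

theorem coeff_eq_edgeCoeff (z : Finset V → Unit →₀ MvPolynomial V k) (T : Finset V) (a b : V) :
    coeff (Finsupp.single a 1 + Finsupp.single b 1) (z T ()) =
      koszulSign k b T * koszulSign k a (insert b T) * edgeCoeff z T a b := by
  have h1 := koszulSign_mul_self (k := k) b T
  have h2 := koszulSign_mul_self (k := k) a (insert b T)
  rw [edgeCoeff]
  set s := coeff (Finsupp.single a 1 + Finsupp.single b 1) (z T ())
  linear_combination (-koszulSign k a (insert b T) * koszulSign k a (insert b T) * s) * h1 - s * h2

theorem edgeCoeff_swap (z : Finset V → Unit →₀ MvPolynomial V k) {T : Finset V} {a b : V}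
    (hab : a ≠ b) (ha : a ∉ T) (hb : b ∉ T) : edgeCoeff z T b a = -edgeCoeff z T a b := by
  rw [edgeCoeff, edgeCoeff, koszulSign_swap hab ha hb,
    add_comm (Finsupp.single b 1) (Finsupp.single a 1), neg_mul]

/-- Only `a`, `b` and `c` divide the monomial, so three terms remain; their signs agree after
normalization because `tripleSign` is invariant under rotation. -/
theorem coeff_koszulD_triple (z : Finset V → Unit →₀ MvPolynomial V k) {T : Finset V} {a b c : V}
    (hab : a ≠ b) (hbc : b ≠ c) (hac : a ≠ c) (ha : a ∉ T) (hb : b ∉ T) (hc : c ∉ T) :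
    coeff (Finsupp.single a 1 + Finsupp.single b 1 + Finsupp.single c 1) (koszulD k _ z T ()) =
      tripleSign k T a b c * (edgeCoeff z (insert c T) a b + edgeCoeff z (insert a T) b c +
        edgeCoeff z (insert b T) c a) := by
  have key : ∀ a b c : V, koszulSign k c T *
      coeff (Finsupp.single a 1 + Finsupp.single b 1) (z (insert c T) ()) =
        tripleSign k T a b c * edgeCoeff z (insert c T) a b := fun a b c => by
    rw [coeff_eq_edgeCoeff, tripleSign]
    ring
  have hsub : ({a, b, c} : Finset V) ⊆ Tᶜ := by
    simp [Finset.insert_subset_iff, ha, hb, hc]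
  rw [coeff_koszulD, ← Finset.sum_subset hsub, Finset.sum_insert (by simp [hab, hac]),
    Finset.sum_pair hbc]
  · rw [if_pos (by simp), if_pos (by simp), if_pos (by simp)]
    have e1 : Finsupp.single a 1 + Finsupp.single b 1 + Finsupp.single c 1 - Finsupp.single a 1 =
        (Finsupp.single b 1 + Finsupp.single c 1 : V →₀ ℕ) := by
      rw [add_assoc, add_tsub_cancel_left]
    have e2 : Finsupp.single a 1 + Finsupp.single b 1 + Finsupp.single c 1 - Finsupp.single b 1 =
        (Finsupp.single c 1 + Finsupp.single a 1 : V →₀ ℕ) := by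
      rw [add_comm (Finsupp.single a 1), add_assoc, add_tsub_cancel_left, add_comm]
    rw [e1, e2, add_tsub_cancel_right, key, key, key, tripleSign_rotate hab hbc hac ha hb hc,
      ← tripleSign_rotate hab hbc hac ha hb hc,
      tripleSign_rotate hbc hac.symm hab.symm hb hc ha]
    ring
  · intro x _ hx
    simp only [Finset.mem_insert, Finset.mem_singleton, not_or] at hx
    rw [if_neg]
    simp [Ne.symm hx.1, Ne.symm hx.2.1, Ne.symm hx.2.2]

variable {G : SimpleGraph V} {i : ℕ}

theorem exists_edge_of_mem_koszulCycles {z : Finset V → Unit →₀ MvPolynomial V k}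
    (hz : z ∈ koszulCycles (G.edgeIdeal k) i (i + 2)) {T : Finset V} {m : V →₀ ℕ}
    (hm : coeff m (z T ()) ≠ 0) :
    ∃ a b, G.Adj a b ∧ m = Finsupp.single a 1 + Finsupp.single b 1 := by
  obtain ⟨a, b, hab, hle⟩ := SimpleGraph.mem_edgeIdeal_iff.1 (hz.2.1 T) m hm
  refine ⟨a, b, hab, (eq_of_le_of_degree_eq hle ?_).symm⟩
  have h : (0 : ℤ) + (m.degree : ℤ) + i = i + 2 := (hz.1 T () m hm).2
  rw [map_add, Finsupp.degree_single, Finsupp.degree_single]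
  omega

theorem coeff_eq_zero_of_not_adj {z : Finset V → Unit →₀ MvPolynomial V k}
    (hz : z ∈ koszulCycles (G.edgeIdeal k) i (i + 2)) (T : Finset V) {a b : V}
    (hab : ¬ G.Adj a b) : coeff (Finsupp.single a 1 + Finsupp.single b 1) (z T ()) = 0 := by
  by_contra hm
  obtain ⟨c, d, hcd, h⟩ := exists_edge_of_mem_koszulCycles hz hm
  rcases single_add_single_eq_iff.1 h with ⟨rfl, rfl⟩ | ⟨rfl, rfl⟩
  · exact hab hcd
  · exact hab hcd.symm

/-- This excludes the multidegrees that are not squarefree. In the boundary at `T` without `a`, the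
monomial `x_a² x_b` arises from this coefficient and otherwise only from `x_a²`, which is not an
edge monomial. -/
theorem coeff_eq_zero_of_mem {z : Finset V → Unit →₀ MvPolynomial V k}
    (hz : z ∈ koszulCycles (G.edgeIdeal k) i (i + 2)) {T : Finset V} {a b : V}
    (ha : a ∈ T) : coeff (Finsupp.single a 1 + Finsupp.single b 1) (z T ()) = 0 := by
  by_cases hab : a = b
  · subst hab
    exact coeff_eq_zero_of_not_adj hz T (G.irrefl)
  have h : coeff (Finsupp.single a 1 + Finsupp.single b 1 + Finsupp.single a 1)
      (koszulD k _ z (T.erase a) ()) = 0 := by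
    rw [hz.2.2]
    simp
  rw [coeff_koszulD, Finset.sum_eq_single a] at h
  · rw [if_pos (by simp), add_tsub_cancel_right, Finset.insert_erase ha] at h
    exact (mul_eq_zero.1 h).resolve_left (koszulSign_ne_zero _ _)
  · intro x _ hx
    split_ifs with h0
    · have hxb : x = b := by
        by_contra hxb
        simp [Ne.symm hx, Ne.symm hxb] at h0
      subst hxb
      rw [add_right_comm, add_tsub_cancel_right, coeff_eq_zero_of_not_adj hz _ G.irrefl, mul_zero]
    · rfl
  · intro h0
    simp at h0

theorem edgeCoeff_add_add {z : Finset V → Unit →₀ MvPolynomial V k}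
    (hz : koszulD k _ z = 0) {T : Finset V} {a b c : V}
    (hab : a ≠ b) (hbc : b ≠ c) (hac : a ≠ c) (ha : a ∉ T) (hb : b ∉ T) (hc : c ∉ T) :
    edgeCoeff z (insert c T) a b + edgeCoeff z (insert a T) b c +
      edgeCoeff z (insert b T) c a = 0 := by
  have h := coeff_koszulD_triple z hab hbc hac ha hb hc
  rw [hz] at h
  refine (mul_eq_zero.1 ((Eq.symm h).trans (by simp))).resolve_left ?_
  exact mul_ne_zero (mul_ne_zero (koszulSign_ne_zero _ _) (koszulSign_ne_zero _ _))
    (koszulSign_ne_zero _ _)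

/-- The functions on the vertices of `H` that are constant on the connected components and that
vanish at `x₀`. -/
def SimpleGraph.potentials (k : Type u) [Field k] {W : Type*} (H : SimpleGraph W) (x₀ : W) :
    Submodule k (W → k) where
  carrier := {f | (∀ a b, H.Adj a b → f a = f b) ∧ f x₀ = 0}
  zero_mem' := by simp
  add_mem' := by
    rintro f g ⟨hf, hf0⟩ ⟨hg, hg0⟩
    exact ⟨fun a b h => by rw [Pi.add_apply, Pi.add_apply, hf a b h, hg a b h], by simp [hf0, hg0]⟩
  smul_mem' := by
    rintro r f ⟨hf, hf0⟩
    exact ⟨fun a b h => by rw [Pi.smul_apply, Pi.smul_apply, hf a b h], by simp [hf0]⟩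

/-- A potential for the edge coefficients of a cycle, normalized to vanish at `x₀`. -/
noncomputable def cyclePotential (S : Finset V) (x₀ a : V) :
    (Finset V → Unit →₀ MvPolynomial V k) →ₗ[k] k where
  toFun z := edgeCoeff z ((S.erase a).erase x₀) a x₀
  map_add' z z' := by
    simp [edgeCoeff, mul_add]
  map_smul' r z := by
    simp [edgeCoeff, mul_left_comm]

theorem cyclePotential_apply (S : Finset V) (x₀ a : V)
    (z : Finset V → Unit →₀ MvPolynomial V k) :
    cyclePotential S x₀ a z = edgeCoeff z ((S.erase a).erase x₀) a x₀ := rfl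

/-- Erasing `x₀` twice removes one element only, which leaves a set of `q + 1` elements, where a
chain of exterior degree `q` vanishes. -/
theorem cyclePotential_self {z : Finset V → Unit →₀ MvPolynomial V k} {q : ℕ} {j : ℤ}
    (hz : z ∈ koszulPart k (fun _ : Unit => 0) q j) {S : Finset V} (hS : S.card = q + 2) {x₀ : V}
    (h₀ : x₀ ∈ S) : cyclePotential S x₀ x₀ z = 0 := by
  have h : z ((S.erase x₀).erase x₀) = 0 := by
    refine apply_eq_zero_of_mem_koszulPart hz ?_
    rw [Finset.erase_eq_of_notMem (by simp), Finset.card_erase_of_mem h₀]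
    omega
  rw [cyclePotential_apply, edgeCoeff, h, Finsupp.zero_apply, coeff_zero, mul_zero]

/-- A closed 1-cochain on a complete graph is a coboundary: apply the cocycle identity to the
triangle `a`, `b`, `x₀`. -/
theorem edgeCoeff_eq_sub {z : Finset V → Unit →₀ MvPolynomial V k}
    (hz : z ∈ koszulCycles (G.edgeIdeal k) i (i + 2)) {S : Finset V} (hS : S.card = i + 2)
    {x₀ a b : V} (h₀ : x₀ ∈ S) (ha : a ∈ S) (hb : b ∈ S) (hab : a ≠ b) :
    edgeCoeff z ((S.erase a).erase b) a b = cyclePotential S x₀ a z - cyclePotential S x₀ b z := by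
  by_cases hb0 : b = x₀
  · subst hb0
    rw [cyclePotential_self hz.1 hS h₀, sub_zero]
    rfl
  by_cases ha0 : a = x₀
  · subst ha0
    rw [cyclePotential_self hz.1 hS h₀, zero_sub, cyclePotential_apply,
      edgeCoeff_swap z hab (by simp) (by simp), neg_neg, Finset.erase_right_comm]
  have h := edgeCoeff_add_add hz.2.2 (T := ((S.erase a).erase b).erase x₀) hab hb0 ha0
    (by simp) (by simp) (by simp)
  have e1 : insert x₀ (((S.erase a).erase b).erase x₀) = (S.erase a).erase b :=
    Finset.insert_erase (by simp [h₀, Ne.symm hb0, Ne.symm ha0])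
  have e2 : insert a (((S.erase a).erase b).erase x₀) = (S.erase b).erase x₀ := by
    rw [Finset.erase_right_comm (a := a), Finset.erase_right_comm (a := a)]
    exact Finset.insert_erase (by simp [ha, hab, ha0])
  have e3 : insert b (((S.erase a).erase b).erase x₀) = (S.erase a).erase x₀ := by
    rw [Finset.erase_right_comm (a := b)]
    exact Finset.insert_erase (by simp [hb, Ne.symm hab, hb0])
  rw [e1, e2, e3, edgeCoeff_swap z ha0 (by simp) (by simp)] at h
  rw [cyclePotential_apply, cyclePotential_apply]
  linear_combination h

open Classical in
/-- The Koszul chain with given coefficients at the squarefree monomials. -/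
noncomputable def edgeChain (i : ℕ) (f : Finset V → V → V → k) :
    Finset V → Unit →₀ MvPolynomial V k :=
  fun T => if T.card = i then Finsupp.single () (∑ a ∈ Tᶜ, ∑ b ∈ Tᶜ,
    if Fintype.equivFin V a < Fintype.equivFin V b then
      monomial (Finsupp.single a 1 + Finsupp.single b 1)
        (koszulSign k b T * koszulSign k a (insert b T) * f T a b) else 0) else 0

theorem exists_of_coeff_edgeChain_ne_zero {f : Finset V → V → V → k} {T : Finset V} {m : V →₀ ℕ}
    (h : coeff m (edgeChain i f T ()) ≠ 0) :
    T.card = i ∧ ∃ a b, a ≠ b ∧ a ∉ T ∧ b ∉ T ∧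
      m = Finsupp.single a 1 + Finsupp.single b 1 ∧ f T a b ≠ 0 := by
  rw [edgeChain] at h
  split_ifs at h with hT
  · refine ⟨hT, ?_⟩
    rw [Finsupp.single_eq_same, coeff_sum] at h
    obtain ⟨a, ha, h⟩ := Finset.exists_ne_zero_of_sum_ne_zero h
    rw [coeff_sum] at h
    obtain ⟨b, hb, h⟩ := Finset.exists_ne_zero_of_sum_ne_zero h
    split_ifs at h with hlt
    · rw [coeff_monomial] at h
      split_ifs at h with hm
      · exact ⟨a, b, fun hab => by simp [hab] at hlt, Finset.mem_compl.1 ha, Finset.mem_compl.1 hb,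
          hm.symm, right_ne_zero_of_mul h⟩
      · exact absurd rfl h
    · simp at h
  · simp at h

/-- The chain contains each unordered pair once, in increasing order; antisymmetry of `f` gives the
other order. -/
theorem edgeCoeff_edgeChain {f : Finset V → V → V → k} {T : Finset V} (hT : T.card = i)
    (hf : ∀ a b, f T b a = -f T a b) {a b : V} (hab : a ≠ b) (ha : a ∉ T) (hb : b ∉ T) :
    edgeCoeff (edgeChain i f) T a b = f T a b := by
  wlog hlt : Fintype.equivFin V a < Fintype.equivFin V b generalizing a b
  · have h2 : Fintype.equivFin V b < Fintype.equivFin V a :=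
      lt_of_le_of_ne (not_lt.1 hlt) fun h' => hab ((Fintype.equivFin V).injective h').symm
    rw [edgeCoeff_swap _ hab.symm hb ha, this hab.symm hb ha h2, hf a b, neg_neg]
  have hc : coeff (Finsupp.single a 1 + Finsupp.single b 1) (edgeChain i f T ()) =
      koszulSign k b T * koszulSign k a (insert b T) * f T a b := by
    rw [edgeChain, if_pos hT, Finsupp.single_eq_same, coeff_sum, Finset.sum_eq_single a, coeff_sum,
      Finset.sum_eq_single b]
    · rw [if_pos hlt, coeff_monomial, if_pos rfl]
    · intro c _ hc
      split_ifs
      · rw [coeff_monomial, if_neg]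
        intro h
        rcases single_add_single_eq_iff.1 h with ⟨-, h⟩ | ⟨h, -⟩
        · exact hc h
        · exact hab h
      · simp
    · simp [hb]
    · intro c _ hc
      rw [coeff_sum]
      refine Finset.sum_eq_zero fun d _ => ?_
      split_ifs with hcd
      · rw [coeff_monomial, if_neg]
        intro h
        rcases single_add_single_eq_iff.1 h with ⟨h, -⟩ | ⟨rfl, rfl⟩
        · exact hc h
        · exact absurd hlt hcd.not_gt
      · simp
    · simp [ha]
  have h1 := koszulSign_mul_self (k := k) b T
  have h2 := koszulSign_mul_self (k := k) a (insert b T)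
  rw [edgeCoeff, hc]
  linear_combination (koszulSign k a (insert b T) * koszulSign k a (insert b T) * f T a b) * h1 +
    f T a b * h2

/-- The differences of a potential telescope around a triangle, which gives the cycle condition, and
they vanish on non-edges, which puts the coefficients in the ideal. -/
theorem edgeChain_mem_koszulCycles {g : Finset V → V → k}
    (hg : ∀ S a b, S.card = i + 2 → a ∈ S → b ∈ S → a ≠ b → ¬ G.Adj a b → g S a = g S b) :
    edgeChain i (fun T a b => g (insert a (insert b T)) a - g (insert a (insert b T)) b) ∈
      koszulCycles (G.edgeIdeal k) i (i + 2) := by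
  set f : Finset V → V → V → k :=
    fun T a b => g (insert a (insert b T)) a - g (insert a (insert b T)) b with hf
  have hfs : ∀ T a b, f T b a = -f T a b := fun T a b => by
    simp only [hf]
    rw [Finset.insert_comm a b, neg_sub]
  refine ⟨?_, ?_, ?_⟩
  · intro T u m hm
    obtain ⟨hT, a, b, -, -, -, rfl, -⟩ := exists_of_coeff_edgeChain_ne_zero hm
    refine ⟨hT, ?_⟩
    simp
    ring
  · intro T
    rw [SimpleGraph.mem_edgeIdeal_iff]
    intro m hm
    obtain ⟨hT, a, b, hab, ha, hb, rfl, h⟩ := exists_of_coeff_edgeChain_ne_zero hm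
    refine ⟨a, b, ?_, le_rfl⟩
    by_contra hadj
    refine h (sub_eq_zero.2 (hg _ _ _ ?_ (by simp) (by simp) hab hadj))
    rw [Finset.card_insert_of_notMem (by simp [hab, ha]), Finset.card_insert_of_notMem hb, hT]
  · ext1 T
    refine finsupp_mvPolynomial_ext fun u m => ?_
    by_contra hne
    rw [Pi.zero_apply, Finsupp.zero_apply, coeff_zero] at hne
    have hne' := hne
    rw [coeff_koszulD] at hne'
    obtain ⟨c, hc, h⟩ := Finset.exists_ne_zero_of_sum_ne_zero hne'
    split_ifs at h with hmc
    · obtain ⟨hT, a, b, hab, ha, hb, hm, -⟩ :=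
        exists_of_coeff_edgeChain_ne_zero (right_ne_zero_of_mul h)
      -- One nonzero summand already forces the monomial to be a product of three distinct variables
      -- outside `T`, so the triple formula applies.
      have hm' : m = Finsupp.single a 1 + Finsupp.single b 1 + Finsupp.single c 1 := by
        rw [← hm, tsub_add_cancel_of_le
          (Finsupp.single_le_iff.2 (Nat.one_le_iff_ne_zero.2 hmc))]
      simp only [Finset.mem_insert, not_or, Finset.mem_compl] at ha hb hc
      have hcT : T.card + 1 = i := by rw [← hT, Finset.card_insert_of_notMem hc]
      refine hne ?_
      rw [hm', coeff_koszulD_triple _ hab hb.1 ha.1 ha.2 hb.2 hc,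
        edgeCoeff_edgeChain hT (hfs _) hab (by simp [ha]) (by simp [hb]),
        edgeCoeff_edgeChain (by rw [Finset.card_insert_of_notMem ha.2, hcT]) (hfs _) hb.1
          (by simp [hb, Ne.symm hab]) (by simp [hc, Ne.symm ha.1]),
        edgeCoeff_edgeChain (by rw [Finset.card_insert_of_notMem hb.2, hcT]) (hfs _)
          (Ne.symm ha.1) (by simp [hc, Ne.symm hb.1]) (by simp [ha, hab])]
      simp only [hf]
      have e1 : insert b (insert c (insert a T)) = insert a (insert b (insert c T)) := by
        ext x
        simp only [Finset.mem_insert]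
        tauto
      have e2 : insert c (insert a (insert b T)) = insert a (insert b (insert c T)) := by
        ext x
        simp only [Finset.mem_insert]
        tauto
      rw [e1, e2]
      ring
    · exact absurd rfl h

end EdgeIdeal

/-! ### Dimension of the linear strand. -/

section LinearStrand

open MvPolynomial GradedFreeResolution

variable {k : Type u} [Field k]

/-- Potentials are functions on the set of components that vanish at the component of `x₀`: the
kernel of one nonzero functional. -/
theorem SimpleGraph.finrank_potentials_add_one {W : Type*} [Finite W] (H : SimpleGraph W)
    (x₀ : W) : Module.finrank k (H.potentials k x₀) + 1 = Nat.card H.ConnectedComponent := by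
  have := Fintype.ofFinite H.ConnectedComponent
  set L : (H.ConnectedComponent → k) →ₗ[k] (W → k) :=
    LinearMap.funLeft k k H.connectedComponentMk
  have hL : Function.Injective L :=
    LinearMap.funLeft_injective_of_surjective k k _ Quot.mk_surjective
  set e : (H.ConnectedComponent → k) →ₗ[k] k :=
    LinearMap.proj (H.connectedComponentMk x₀)
  have he : LinearMap.range e = ⊤ :=
    LinearMap.range_eq_top.2 fun r => ⟨fun _ => r, rfl⟩
  have hpot : H.potentials k x₀ = (LinearMap.ker e).map L := by
    ext f
    constructor
    · rintro ⟨hf, hf0⟩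
      have hw : ∀ (a b : W) (p : H.Walk a b), f a = f b := fun a b p => by
        induction p with
        | nil => rfl
        | cons h p ih => rw [hf _ _ h, ih]
      exact ⟨SimpleGraph.ConnectedComponent.lift f fun a b p _ => hw a b p, hf0, rfl⟩
    · rintro ⟨g, hg, rfl⟩
      refine ⟨fun a b h => ?_, hg⟩
      change g (H.connectedComponentMk a) = g (H.connectedComponentMk b)
      rw [SimpleGraph.ConnectedComponent.connectedComponentMk_eq_of_adj h]
  have h1 := LinearMap.finrank_range_add_finrank_ker e
  rw [he, finrank_top, Module.finrank_self, Module.finrank_fintype_fun_eq_card] at h1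
  rw [hpot, LinearEquiv.finrank_eq ((LinearMap.ker e).equivMapOfInjective L hL).symm,
    Nat.card_eq_fintype_card]
  omega

variable {V : Type v} [Fintype V] [DecidableEq V] {G : SimpleGraph V} {i : ℕ}

theorem exists_cycle_of_potentials (x₀ : ∀ S : Finset V, S.card = i + 2 → V)
    (h₀ : ∀ S hS, x₀ S hS ∈ S)
    (g : Finset V → V → k)
    (hg : ∀ S a b, S.card = i + 2 → a ∈ S → b ∈ S → a ≠ b → ¬ G.Adj a b → g S a = g S b)
    (hg0 : ∀ S hS, g S (x₀ S hS) = 0) :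
    ∃ z ∈ koszulCycles (G.edgeIdeal k) i (i + 2), ∀ S hS, ∀ a ∈ S,
      cyclePotential S (x₀ S hS) a z = g S a := by
  refine ⟨_, edgeChain_mem_koszulCycles hg, fun S hS a ha => ?_⟩
  by_cases hab : a = x₀ S hS
  · rw [hab, cyclePotential_self (edgeChain_mem_koszulCycles hg).1 hS (h₀ S hS), hg0 S hS]
  · have hx : x₀ S hS ∈ S.erase a := Finset.mem_erase.2 ⟨Ne.symm hab, h₀ S hS⟩
    have hT : ((S.erase a).erase (x₀ S hS)).card = i := by
      rw [Finset.card_erase_of_mem hx, Finset.card_erase_of_mem ha]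
      omega
    rw [cyclePotential_apply, edgeCoeff_edgeChain hT ?_ hab (by simp) (by simp),
      Finset.insert_erase hx, Finset.insert_erase ha, hg0 S hS, sub_zero]
    intro a b
    rw [Finset.insert_comm a b, neg_sub]

/-- Every possibly nonzero coefficient sits at an edge `ab` with `a, b ∉ T`, and up to sign it is a
difference of two potentials on `T ∪ {a, b}`. -/
theorem eq_zero_of_cyclePotential_eq_zero {z : Finset V → Unit →₀ MvPolynomial V k}
    (hz : z ∈ koszulCycles (G.edgeIdeal k) i (i + 2)) (x₀ : ∀ S : Finset V, S.card = i + 2 → V)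
    (h₀ : ∀ S hS, x₀ S hS ∈ S)
    (h : ∀ S hS, ∀ a ∈ S, cyclePotential S (x₀ S hS) a z = 0) : z = 0 := by
  ext1 T
  refine finsupp_mvPolynomial_ext fun u m => ?_
  by_contra hm
  rw [Pi.zero_apply, Finsupp.zero_apply, coeff_zero] at hm
  have hT := (hz.1 T u m hm).1
  obtain ⟨a, b, hab, rfl⟩ := exists_edge_of_mem_koszulCycles hz hm
  have ha : a ∉ T := fun ha => hm (coeff_eq_zero_of_mem hz ha)
  have hb : b ∉ T := fun hb => hm (by rw [add_comm]; exact coeff_eq_zero_of_mem hz hb)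
  have haS : a ∉ insert b T := by simp [hab.ne, ha]
  have hS : (insert a (insert b T)).card = i + 2 := by
    rw [Finset.card_insert_of_notMem haS, Finset.card_insert_of_notMem hb, hT]
  have h1 := edgeCoeff_eq_sub hz hS (h₀ _ hS) (a := a) (b := b) (by simp) (by simp) hab.ne
  rw [h _ hS a (by simp), h _ hS b (by simp), sub_zero, Finset.erase_insert haS,
    Finset.erase_insert hb] at h1
  refine hm ?_
  change coeff _ (z T ()) = 0
  rw [coeff_eq_edgeCoeff, h1, mul_zero]

/-- The cycles of the linear strand decompose according to the squarefree multidegrees. -/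
theorem nonempty_koszulCycles_equiv (x₀ : ∀ S : Finset.powersetCard (i + 2) (Finset.univ : Finset V),
      ((S : Finset V) : Set V)) :
    Nonempty (koszulCycles (G.edgeIdeal k) i (i + 2) ≃ₗ[k]
      ∀ S : Finset.powersetCard (i + 2) (Finset.univ : Finset V),
        SimpleGraph.potentials k (G.induce ((S : Finset V) : Set V))ᶜ (x₀ S)) := by
  classical
  have hcard : ∀ S : Finset.powersetCard (i + 2) (Finset.univ : Finset V), S.1.card = i + 2 :=
    fun S => (Finset.mem_powersetCard.1 S.2).2
  have hmem : ∀ S : Finset V, S.card = i + 2 →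
      S ∈ Finset.powersetCard (i + 2) (Finset.univ : Finset V) := fun S hS => by
    simp [Finset.mem_powersetCard, hS]
  have hpot : ∀ (z : koszulCycles (G.edgeIdeal k) i (i + 2))
      (S : Finset.powersetCard (i + 2) (Finset.univ : Finset V)),
      (fun a : ((S : Finset V) : Set V) => cyclePotential S.1 (x₀ S) a z.1) ∈
        SimpleGraph.potentials k (G.induce ((S : Finset V) : Set V))ᶜ (x₀ S) := by
    intro z S
    refine ⟨fun a b hab => ?_, cyclePotential_self z.2.1 (hcard S) (x₀ S).2⟩
    rw [SimpleGraph.compl_adj] at hab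
    have hne : (a : V) ≠ b := fun h => hab.1 (Subtype.ext h)
    have h1 := edgeCoeff_eq_sub z.2 (hcard S) (x₀ S).2 a.2 b.2 hne
    rw [edgeCoeff, coeff_eq_zero_of_not_adj z.2 _ (a := a) (b := b) hab.2, mul_zero] at h1
    exact (sub_eq_zero.1 h1.symm)
  set Φ : koszulCycles (G.edgeIdeal k) i (i + 2) →ₗ[k]
      ∀ S : Finset.powersetCard (i + 2) (Finset.univ : Finset V),
        SimpleGraph.potentials k (G.induce ((S : Finset V) : Set V))ᶜ (x₀ S) :=
    { toFun := fun z S => ⟨fun a => cyclePotential S.1 (x₀ S) a z.1, hpot z S⟩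
      map_add' := fun z z' => funext fun S => Subtype.ext (funext fun a => map_add _ _ _)
      map_smul' := fun r z => funext fun S => Subtype.ext (funext fun a => map_smul _ _ _) }
  set y₀ : ∀ S : Finset V, S.card = i + 2 → V := fun S hS => x₀ ⟨S, hmem S hS⟩
  have hy : ∀ S hS, y₀ S hS ∈ S := fun S hS => (x₀ ⟨S, hmem S hS⟩).2
  refine ⟨LinearEquiv.ofBijective Φ ⟨?_, ?_⟩⟩
  · rw [injective_iff_map_eq_zero]
    intro z hz
    refine Subtype.ext (eq_zero_of_cyclePotential_eq_zero z.2 y₀ hy fun S hS a ha => ?_)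
    exact congrFun (congrArg Subtype.val (congrFun hz ⟨S, hmem S hS⟩)) ⟨a, ha⟩
  · intro f
    obtain ⟨z, hz, hzg⟩ := exists_cycle_of_potentials (k := k) (G := G) y₀ hy
      (fun S a => if h : S.card = i + 2 ∧ a ∈ S then (f ⟨S, hmem S h.1⟩).1 ⟨a, h.2⟩ else 0)
      (fun S a b hS ha hb hab hadj => by
        rw [dif_pos ⟨hS, ha⟩, dif_pos ⟨hS, hb⟩]
        refine (f ⟨S, hmem S hS⟩).2.1 _ _ ?_
        rw [SimpleGraph.compl_adj]
        exact ⟨fun h => hab (congrArg Subtype.val h), hadj⟩)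
      (fun S hS => by
        rw [dif_pos ⟨hS, hy S hS⟩]
        exact (f ⟨S, hmem S hS⟩).2.2)
    refine ⟨⟨z, hz⟩, funext fun S => Subtype.ext (funext fun a => ?_)⟩
    have h := hzg S.1 (hcard S) a.1 a.2
    rw [dif_pos ⟨hcard S, a.2⟩] at h
    exact h

/-- The Betti numbers of the linear strand of an edge ideal. -/
theorem betti_edgeIdeal_linear (F : GradedFreeResolution.{u, v, w} (G.edgeIdeal k)) (i : ℕ) :
    Module.Finite k (F.Tor (i + 1) ((i + 1 : ℕ) + 2)) ∧
    (F.betti (i + 1) ((i + 1 : ℕ) + 2) : ℤ) =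
      ∑ S ∈ Finset.powersetCard (i + 1 + 2) (Finset.univ : Finset V),
        ((Nat.card (G.induce (S : Set V))ᶜ.ConnectedComponent : ℤ) - 1) := by
  obtain ⟨e⟩ := F.nonempty_tor_equiv_koszulCycles (i := i) (j := (i + 1 : ℕ) + 2)
    fun z hz hI => SimpleGraph.eq_zero_of_mem_edgeIdeal hz hI
  have hne : ∀ S : Finset.powersetCard (i + 1 + 2) (Finset.univ : Finset V),
      Nonempty ((S : Finset V) : Set V) := fun S => by
    have h := (Finset.mem_powersetCard.1 S.2).2
    obtain ⟨a, ha⟩ : S.1.Nonempty := Finset.card_pos.1 (by omega)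
    exact ⟨⟨a, ha⟩⟩
  obtain ⟨e'⟩ := nonempty_koszulCycles_equiv (k := k) (G := G) fun S => (hne S).some
  have hfin := Module.Finite.equiv e'.symm
  refine ⟨Module.Finite.equiv e.symm, ?_⟩
  rw [betti, e.finrank_eq, e'.finrank_eq, Module.finrank_pi_fintype, Nat.cast_sum,
    ← Finset.sum_coe_sort (Finset.powersetCard (i + 1 + 2) (Finset.univ : Finset V))]
  refine Finset.sum_congr rfl fun S _ => ?_
  rw [← SimpleGraph.finrank_potentials_add_one (k := k) _ (hne S).some]
  simp

end LinearStrand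

/-! ### Existence of graded free resolutions. -/

section ExistsResolution

open MvPolynomial

variable {k : Type u} [Field k] {V : Type v} {B : Type w}

theorem exists_eq_sum_homogeneousPart (deg : B → ℤ) (f : B →₀ MvPolynomial V k) :
    ∃ J : Finset ℤ, f = ∑ j ∈ J, homogeneousPart deg j f := by
  classical
  refine ⟨f.support.biUnion fun b => (f b).support.image fun m => deg b + (m.degree : ℤ),
    finsupp_mvPolynomial_ext fun b m => ?_⟩
  rw [Finsupp.finsetSum_apply, coeff_sum]
  simp only [coeff_homogeneousPart]
  rw [Finset.sum_ite_eq]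
  split_ifs with h
  · rfl
  · by_contra hm
    refine h (Finset.mem_biUnion.2 ⟨b, ?_, Finset.mem_image.2
      ⟨m, MvPolynomial.mem_support_iff.2 hm, rfl⟩⟩)
    rw [Finsupp.mem_support_iff]
    intro h0
    simp [h0] at hm

/-- A graded submodule of a finite graded free module is the image of a finite graded free
module. -/
theorem exists_graded_cover [Finite V] [Finite B] (deg : B → ℤ)
    (K : Submodule (MvPolynomial V k) (B →₀ MvPolynomial V k))
    (hK : ∀ f ∈ K, ∀ j, homogeneousPart deg j f ∈ K) :
    ∃ (n : ℕ) (deg' : ULift.{w} (Fin n) → ℤ)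
      (D : (ULift.{w} (Fin n) →₀ MvPolynomial V k) →ₗ[MvPolynomial V k] (B →₀ MvPolynomial V k)),
      (∀ b, IsHomogeneousVec deg (D (Finsupp.single b 1)) (deg' b)) ∧ LinearMap.range D = K := by
  classical
  -- Finitely many generators exist by the Hilbert basis theorem; their homogeneous parts lie in `K`
  -- and generate it as well.
  obtain ⟨s, hs⟩ := IsNoetherian.noetherian K
  choose J hJ using exists_eq_sum_homogeneousPart (k := k) (V := V) deg
  set t : Finset (B →₀ MvPolynomial V k) :=
    s.biUnion fun f => (J f).image fun j => homogeneousPart deg j f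
  have ht : ∀ g ∈ t, ∃ j, IsHomogeneousVec deg g j := by
    intro g hg
    obtain ⟨f, -, hg⟩ := Finset.mem_biUnion.1 hg
    obtain ⟨j, -, rfl⟩ := Finset.mem_image.1 hg
    exact ⟨j, isHomogeneousVec_homogeneousPart _ _ _⟩
  have hspan : Submodule.span (MvPolynomial V k) (t : Set (B →₀ MvPolynomial V k)) = K := by
    refine le_antisymm (Submodule.span_le.2 fun g hg => ?_) ?_
    · obtain ⟨f, hf, hg⟩ := Finset.mem_biUnion.1 (Finset.mem_coe.1 hg)
      obtain ⟨j, -, rfl⟩ := Finset.mem_image.1 hg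
      exact hK f (hs ▸ Submodule.subset_span hf) j
    · rw [← hs]
      refine Submodule.span_le.2 fun f hf => ?_
      rw [hJ f]
      exact Submodule.sum_mem _ fun j hj => Submodule.subset_span <| Finset.mem_coe.2 <|
        Finset.mem_biUnion.2 ⟨f, hf, Finset.mem_image_of_mem _ hj⟩
  choose e he using ht
  set φ : ULift.{w} (Fin t.card) ≃ t := Equiv.ulift.trans t.equivFin.symm
  refine ⟨t.card, fun b => e (φ b) (φ b).2,
    Finsupp.linearCombination _ fun b => (φ b : B →₀ MvPolynomial V k), fun b => ?_, ?_⟩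
  · rw [Finsupp.linearCombination_single, one_smul]
    exact he _ _
  · rw [Finsupp.range_linearCombination, ← hspan]
    congr 1
    ext g
    constructor
    · rintro ⟨b, rfl⟩
      exact (φ b).2
    · intro hg
      exact ⟨φ.symm ⟨g, hg⟩, by simp⟩

/-- A graded submodule of a finite graded free module over `k[x_v : v ∈ V]`. -/
structure GradedSubmodule (k : Type u) [Field k] (V : Type v) where
  /-- the homogeneous basis of the free module -/
  B : Type w
  finite : Finite B
  /-- the degrees of the basis elements -/
  deg : B → ℤ
  /-- the submodule -/
  K : Submodule (MvPolynomial V k) (B →₀ MvPolynomial V k)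
  homogeneousPart_mem : ∀ f ∈ K, ∀ j, homogeneousPart deg j f ∈ K

namespace GradedSubmodule

variable [Finite V]

/-- The kernel of a degree-preserving map is again graded, so covering can be iterated. -/
theorem exists_cover (S : GradedSubmodule.{u, v, w} k V) :
    ∃ (S' : GradedSubmodule.{u, v, w} k V)
      (D : (S'.B →₀ MvPolynomial V k) →ₗ[MvPolynomial V k] (S.B →₀ MvPolynomial V k)),
      (∀ b, IsHomogeneousVec S.deg (D (Finsupp.single b 1)) (S'.deg b)) ∧
        LinearMap.range D = S.K ∧ S'.K = LinearMap.ker D := by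
  have := S.finite
  obtain ⟨n, deg', D, hD, hr⟩ := exists_graded_cover S.deg S.K S.homogeneousPart_mem
  refine ⟨⟨ULift.{w} (Fin n), inferInstance, deg', LinearMap.ker D, fun f hf j => ?_⟩,
    D, hD, hr, rfl⟩
  rw [LinearMap.mem_ker, map_homogeneousPart D hD, LinearMap.mem_ker.1 hf, homogeneousPart_zero]

/-- The module of relations between finitely many homogeneous generators. -/
noncomputable def syzygy (S : GradedSubmodule.{u, v, w} k V) : GradedSubmodule.{u, v, w} k V :=
  S.exists_cover.choose

/-- The map given by finitely many homogeneous generators. -/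
noncomputable def cover (S : GradedSubmodule.{u, v, w} k V) :
    (S.syzygy.B →₀ MvPolynomial V k) →ₗ[MvPolynomial V k] (S.B →₀ MvPolynomial V k) :=
  S.exists_cover.choose_spec.choose

theorem cover_homogeneous (S : GradedSubmodule.{u, v, w} k V) (b : S.syzygy.B) :
    IsHomogeneousVec S.deg (S.cover (Finsupp.single b 1)) (S.syzygy.deg b) :=
  S.exists_cover.choose_spec.choose_spec.1 b

theorem range_cover (S : GradedSubmodule.{u, v, w} k V) : LinearMap.range S.cover = S.K :=
  S.exists_cover.choose_spec.choose_spec.2.1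

theorem syzygy_K (S : GradedSubmodule.{u, v, w} k V) : S.syzygy.K = LinearMap.ker S.cover :=
  S.exists_cover.choose_spec.choose_spec.2.2

/-- The iterated syzygy modules. -/
noncomputable def iterSyzygy (S : GradedSubmodule.{u, v, w} k V) :
    ℕ → GradedSubmodule.{u, v, w} k V
  | 0 => S
  | i + 1 => (iterSyzygy S i).syzygy

end GradedSubmodule

theorem nonempty_gradedFreeResolution [Finite V] (I : Ideal (MvPolynomial V k))
    (hI : ∀ f ∈ I, ∀ j, homogeneousComponent j f ∈ I) :
    Nonempty (GradedFreeResolution.{u, v, w} I) := by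
  set S : GradedSubmodule.{u, v, w} k V :=
    { B := PUnit
      finite := inferInstance
      deg := fun _ => 0
      K := Submodule.comap (Finsupp.lapply PUnit.unit) I
      homogeneousPart_mem := fun f hf j => by
        rw [Submodule.mem_comap, Finsupp.lapply_apply, homogeneousPart, Finsupp.onFinset_apply]
        split_ifs
        · exact hI _ hf _
        · exact I.zero_mem }
  set aug : (S.syzygy.B →₀ MvPolynomial V k) →ₗ[MvPolynomial V k] MvPolynomial V k :=
    Finsupp.lapply PUnit.unit ∘ₗ S.cover
  have haug : LinearMap.ker aug = LinearMap.ker S.cover := by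
    ext f
    rw [LinearMap.mem_ker, LinearMap.mem_ker, Finsupp.ext_iff]
    exact ⟨fun h _ => h, fun h => h _⟩
  have haug' : LinearMap.range aug = I := by
    rw [LinearMap.range_comp, S.range_cover]
    exact Submodule.map_comap_eq_of_surjective (fun f => ⟨Finsupp.single PUnit.unit f, Finsupp.single_eq_same⟩) _
  have haug'' : LinearMap.ker aug = LinearMap.range S.syzygy.cover := by
    rw [haug, ← S.syzygy_K, S.syzygy.range_cover]
  -- The shift by one occurs because the zeroth stage is the rank one module that contains `I`; the
  -- resolution starts with the basis that covers it.
  refine ⟨⟨fun i => (S.iterSyzygy (i + 1)).B, fun i => (S.iterSyzygy (i + 1)).deg,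
    fun i => (S.iterSyzygy (i + 1)).cover, aug,
    fun i b => (S.iterSyzygy (i + 1)).cover_homogeneous b, fun b m hm => ?_, haug', haug'',
    fun i => ?_⟩⟩
  · have h := S.cover_homogeneous b PUnit.unit m hm
    rwa [zero_add] at h
  · exact (S.iterSyzygy (i + 1)).syzygy_K.symm.trans (S.iterSyzygy (i + 2)).range_cover.symm

theorem SimpleGraph.homogeneousComponent_mem_edgeIdeal {G : SimpleGraph V} {f : MvPolynomial V k}
    (hf : f ∈ G.edgeIdeal k) (j : ℕ) : homogeneousComponent j f ∈ G.edgeIdeal k := by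
  rw [SimpleGraph.mem_edgeIdeal_iff] at hf ⊢
  intro m hm
  rw [coeff_homogeneousComponent] at hm
  split_ifs at hm with h
  · exact hf m hm
  · exact absurd rfl hm

end ExistsResolution

/-! ### Counting the components of a small graph. -/

section GraphCounting

namespace SimpleGraph

variable {W : Type*}

/-- The connected components with at least two vertices. -/
def nontrivialComponents (H : SimpleGraph W) : Set H.ConnectedComponent :=
  {c | ∃ a b, H.Adj a b ∧ H.connectedComponentMk a = c}

/-- Some two edges of the graph lie in different connected components. -/
def HasSeparatedEdges (H : SimpleGraph W) : Prop :=
  ∃ a b c d, H.Adj a b ∧ H.Adj c d ∧ ¬ H.Reachable a c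

/-- A component is either one isolated vertex or contains an edge. -/
theorem card_connectedComponent [Finite W] (H : SimpleGraph W) :
    Nat.card H.ConnectedComponent =
      {x | ∀ y, ¬ H.Adj x y}.ncard + H.nontrivialComponents.ncard := by
  have hinj : Set.InjOn H.connectedComponentMk {x | ∀ y, ¬ H.Adj x y} := by
    intro x hx y _ hxy
    obtain ⟨p⟩ := ConnectedComponent.exact hxy
    cases p with
    | nil => rfl
    | cons h p => exact absurd h (hx _)
  have hdisj : Disjoint (H.connectedComponentMk '' {x | ∀ y, ¬ H.Adj x y})
      H.nontrivialComponents := by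
    rw [Set.disjoint_left]
    rintro _ ⟨x, hx, rfl⟩ ⟨a, b, hab, h⟩
    obtain ⟨p⟩ := ConnectedComponent.exact h.symm
    cases p with
    | nil => exact hx _ hab
    | cons h p => exact hx _ h
  rw [← hinj.ncard_image, ← Set.ncard_union_eq hdisj, ← Set.ncard_univ]
  congr 1
  refine (Set.eq_univ_of_forall fun c => ?_).symm
  induction c using ConnectedComponent.ind with
  | h x =>
    by_cases hx : ∀ y, ¬ H.Adj x y
    · exact Or.inl ⟨x, hx, rfl⟩
    · push Not at hx
      obtain ⟨y, hy⟩ := hx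
      exact Or.inr ⟨x, y, hy, rfl⟩

-- Three components with an edge would need six vertices, so there are at most two.
open Classical in
theorem ncard_nontrivialComponents [Fintype W] (H : SimpleGraph W) (hW : Fintype.card W ≤ 5) :
    (H.nontrivialComponents.ncard : ℤ) =
      1 - (if H = ⊥ then 1 else 0) + (if H.HasSeparatedEdges then 1 else 0) := by
  by_cases hbot : H = ⊥
  · have h1 : H.nontrivialComponents = ∅ := by
      ext c
      simp [nontrivialComponents, hbot]
    have h2 : ¬ H.HasSeparatedEdges := by
      rintro ⟨a, b, c, d, hab, -⟩
      simp [hbot] at hab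
    rw [h1, if_pos hbot, if_neg h2]
    simp
  rw [if_neg hbot]
  by_cases hsep : H.HasSeparatedEdges
  · rw [if_pos hsep]
    obtain ⟨a, b, c, d, hab, hcd, hac⟩ := hsep
    have h2 : H.nontrivialComponents =
        {H.connectedComponentMk a, H.connectedComponentMk c} := by
      ext f
      constructor
      · rintro ⟨x, y, hxy, rfl⟩
        by_contra h
        simp only [Set.mem_insert_iff, Set.mem_singleton_iff, not_or] at h
        have e1 := ConnectedComponent.connectedComponentMk_eq_of_adj hab
        have e2 := ConnectedComponent.connectedComponentMk_eq_of_adj hcd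
        have e3 := ConnectedComponent.connectedComponentMk_eq_of_adj hxy
        have hac' : H.connectedComponentMk a ≠ H.connectedComponentMk c :=
          fun h => hac (ConnectedComponent.exact h)
        have hnd : [a, b, c, d, x, y].Nodup := by
          have n1 : a ≠ c := fun h => hac' (by rw [h])
          have n2 : a ≠ d := fun h => hac' (by rw [h, e2])
          have n3 : b ≠ c := fun h => hac' (by rw [e1, h])
          have n4 : b ≠ d := fun h => hac' (by rw [e1, h, e2])
          have n5 : a ≠ x := fun h' => h.1 (by rw [h'])
          have n6 : a ≠ y := fun h' => h.1 (by rw [h', e3])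
          have n7 : b ≠ x := fun h' => h.1 (by rw [e1, h'])
          have n8 : b ≠ y := fun h' => h.1 (by rw [e1, h', e3])
          have n9 : c ≠ x := fun h' => h.2 (by rw [h'])
          have n10 : c ≠ y := fun h' => h.2 (by rw [h', e3])
          have n11 : d ≠ x := fun h' => h.2 (by rw [e2, h'])
          have n12 : d ≠ y := fun h' => h.2 (by rw [e2, h', e3])
          simp [hab.ne, hcd.ne, hxy.ne, *]
        have := hnd.length_le_card
        simp at this
        omega
      · rintro (rfl | rfl)
        · exact ⟨a, b, hab, rfl⟩
        · exact ⟨c, d, hcd, rfl⟩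
    rw [h2, Set.ncard_pair fun h => hac (ConnectedComponent.exact h)]
    norm_num
  · rw [if_neg hsep]
    obtain ⟨a, b, hab⟩ := ne_bot_iff_exists_adj.1 hbot
    have h2 : H.nontrivialComponents = {H.connectedComponentMk a} := by
      ext f
      constructor
      · rintro ⟨x, y, hxy, rfl⟩
        by_contra h
        exact hsep ⟨x, y, a, b, hxy, hab, fun h' => h (ConnectedComponent.sound h')⟩
      · rintro rfl
        exact ⟨a, b, hab, rfl⟩
    rw [h2, Set.ncard_singleton]
    norm_num

open Classical in
theorem card_connectedComponent_compl_sub_one [Fintype W] (G : SimpleGraph W)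
    (hW : Fintype.card W ≤ 5) :
    (Nat.card Gᶜ.ConnectedComponent : ℤ) - 1 = ({x | ∀ y, y ≠ x → G.Adj x y}.ncard : ℤ) -
      (if G = ⊤ then 1 else 0) + (if Gᶜ.HasSeparatedEdges then 1 else 0) := by
  have h1 : {x | ∀ y, ¬ Gᶜ.Adj x y} = {x | ∀ y, y ≠ x → G.Adj x y} := by
    ext x
    simp only [compl_adj, Set.mem_ofPred_eq, not_and, not_not]
    exact forall_congr' fun y => by rw [ne_comm]
  have h2 : Gᶜ = ⊥ ↔ G = ⊤ := compl_eq_bot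
  rw [card_connectedComponent, Nat.cast_add, ncard_nontrivialComponents _ hW, h1]
  simp only [h2]
  ring

theorem nonempty_iso_completeGraph_iff [Fintype W] (G : SimpleGraph W) {n : ℕ}
    (hW : Fintype.card W = n) : Nonempty (G ≃g completeGraph (Fin n)) ↔ G = ⊤ := by
  constructor
  · rintro ⟨e⟩
    ext a b
    rw [← e.map_adj_iff]
    simp [completeGraph]
  · rintro rfl
    exact ⟨Iso.completeGraph (Fintype.equivFinOfCardEq hW)⟩

/-- A set that is closed under adjacency contains the components of its points. -/
theorem not_reachable_of_closed {H : SimpleGraph W} {s : Set W}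
    (hs : ∀ a b, H.Adj a b → a ∈ s → b ∈ s) {a b : W} (ha : a ∈ s) (hb : b ∉ s) :
    ¬ H.Reachable a b := by
  rintro ⟨p⟩
  induction p with
  | nil => exact hb ha
  | cons h p ih => exact ih (hs _ _ h ha) hb

theorem HasSeparatedEdges.map {W' : Type*} {H : SimpleGraph W} {H' : SimpleGraph W'} (e : H ≃g H')
    (h : H.HasSeparatedEdges) : H'.HasSeparatedEdges := by
  obtain ⟨a, b, c, d, hab, hcd, hac⟩ := h
  exact ⟨e a, e b, e c, e d, e.map_adj_iff.2 hab, e.map_adj_iff.2 hcd,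
    fun h => hac (e.reachable_iff.1 h)⟩

end SimpleGraph

end GraphCounting

/-! ### Graphs on four or five vertices whose complement has separated edges. -/

section SmallGraphs

namespace SimpleGraph

variable {W : Type*} {W' : Type*}

instance (A B : Type*) : DecidableRel (completeBipartiteGraph A B).Adj := fun a b =>
  inferInstanceAs (Decidable (a.isLeft ∧ b.isRight ∨ a.isRight ∧ b.isLeft))

instance (n : ℕ) : DecidableRel (wheelGraph n).Adj
  | some a, some b => inferInstanceAs (Decidable ((cycleGraph n).Adj a b))
  | some _, none => isTrue trivial
  | none, some _ => isTrue trivial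
  | none, none => isFalse id

instance : DecidableRel graphD.Adj := fun a b =>
  decidable_of_iff ((s(a, b) = s(0, 1) ∨ s(a, b) = s(0, 2) ∨ s(a, b) = s(1, 3) ∨
    s(a, b) = s(2, 3) ∨ s(a, b) = s(1, 4) ∨ s(a, b) = s(2, 4) ∨ s(a, b) = s(3, 4)) ∧ a ≠ b)
    Iff.rfl

theorem nonempty_iso_of_injective [Fintype W] [Fintype W'] {G : SimpleGraph W}
    {H : SimpleGraph W'} (hcard : Fintype.card W' = Fintype.card W) (e : W' → W)
    (he : Function.Injective e) (hadj : ∀ a b, G.Adj (e a) (e b) ↔ H.Adj a b) :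
    Nonempty (G ≃g H) := by
  have hb : Function.Bijective e := (Fintype.bijective_iff_injective_and_card e).2 ⟨he, hcard⟩
  exact ⟨RelIso.symm ⟨Equiv.ofBijective e hb, fun {a b} => hadj a b⟩⟩

theorem hasSeparatedEdges_of_closed {H : SimpleGraph W} (s : W → Prop)
    (hs : ∀ a b, H.Adj a b → s a → s b) {a b c d : W} (hab : H.Adj a b) (hcd : H.Adj c d)
    (ha : s a) (hc : ¬ s c) : H.HasSeparatedEdges :=
  ⟨a, b, c, d, hab, hcd, not_reachable_of_closed (s := {x | s x}) hs ha hc⟩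

theorem hasSeparatedEdges_compl_of_iso {G : SimpleGraph W} {H : SimpleGraph W'} (e : G ≃g H)
    (h : Hᶜ.HasSeparatedEdges) : Gᶜ.HasSeparatedEdges :=
  h.map ⟨e.symm.toEquiv, fun {a b} => by
    rw [compl_adj, compl_adj]
    exact and_congr e.symm.injective.ne_iff (not_congr e.symm.map_adj_iff)⟩

theorem hasSeparatedEdges_compl_completeBipartiteGraph_two_two :
    (completeBipartiteGraph (Fin 2) (Fin 2))ᶜ.HasSeparatedEdges :=
  hasSeparatedEdges_of_closed (fun x => x.isLeft) (by decide)
    (a := .inl 0) (b := .inl 1) (c := .inr 0) (d := .inr 1)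
    (by decide) (by decide) (by decide) (by decide)

theorem hasSeparatedEdges_compl_completeBipartiteGraph_two_three :
    (completeBipartiteGraph (Fin 2) (Fin 3))ᶜ.HasSeparatedEdges :=
  hasSeparatedEdges_of_closed (fun x => x.isLeft) (by decide)
    (a := .inl 0) (b := .inl 1) (c := .inr 0) (d := .inr 1)
    (by decide) (by decide) (by decide) (by decide)

/-- The complement consists of the two diagonals of the square and the isolated hub. -/
theorem hasSeparatedEdges_compl_wheelGraph_four : (wheelGraph 4)ᶜ.HasSeparatedEdges :=
  hasSeparatedEdges_of_closed (fun x => x = some 0 ∨ x = some 2) (by decide)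
    (a := some 0) (b := some 2) (c := some 1) (d := some 3)
    (by decide) (by decide) (by decide) (by decide)

/-- The complement is the edge `{1, 2}` together with the path `3 - 0 - 4`. -/
theorem hasSeparatedEdges_compl_graphD : graphDᶜ.HasSeparatedEdges :=
  hasSeparatedEdges_of_closed (fun x => x = 1 ∨ x = 2) (by decide)
    (a := 1) (b := 2) (c := 0) (d := 3)
    (by decide) (by decide) (by decide) (by decide)

/-- The hub is joined to all other vertices, a property that isomorphisms preserve and that `H`
lacks. -/
theorem not_nonempty_iso_wheelGraph {G : SimpleGraph W} (e : G ≃g wheelGraph 4)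
    {H : SimpleGraph W'} (hH : ∀ x, ∃ y, y ≠ x ∧ ¬ H.Adj x y) : ¬ Nonempty (G ≃g H) := by
  rintro ⟨e'⟩
  obtain ⟨y, hy, h⟩ := hH (e' (e.symm none))
  have h1 : e.symm (e (e'.symm y)) = e'.symm y := e.symm_apply_apply _
  obtain ⟨z, hz⟩ : ∃ z, e (e'.symm y) = some z := by
    rw [← Option.ne_none_iff_exists']
    intro h0
    rw [h0] at h1
    rw [h1] at hy
    exact hy (e'.apply_symm_apply y).symm
  refine h ?_
  rw [← e'.apply_symm_apply y, e'.map_adj_iff, ← e.map_adj_iff, hz, e.apply_symm_apply]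
  trivial

/-- `graphD` contains the triangle `1, 3, 4`, and a bipartite graph has none. -/
theorem not_nonempty_iso_graphD {G : SimpleGraph W}
    (e : G ≃g completeBipartiteGraph (Fin 2) (Fin 3)) : ¬ Nonempty (G ≃g graphD) := by
  rintro ⟨e'⟩
  have h : ∀ a b c, (completeBipartiteGraph (Fin 2) (Fin 3)).Adj a b →
      (completeBipartiteGraph (Fin 2) (Fin 3)).Adj b c →
      ¬ (completeBipartiteGraph (Fin 2) (Fin 3)).Adj a c := by decide
  refine h (e (e'.symm 1)) (e (e'.symm 3)) (e (e'.symm 4)) ?_ ?_ ?_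
  all_goals
    rw [e.map_adj_iff, e'.symm.map_adj_iff]
    decide

/-- Vertices in different components of the complement are adjacent. -/
theorem adj_of_not_reachable_compl {G : SimpleGraph W} {x y : W} (h : ¬ Gᶜ.Reachable x y) :
    G.Adj x y := by
  by_contra hxy
  refine h (Adj.reachable ?_)
  rw [compl_adj]
  exact ⟨fun h' => h (h' ▸ Reachable.refl _), hxy⟩

/-- The four ends of two separated edges of the complement form an induced square, and no vertex is
joined to both edges in the complement. -/
theorem HasSeparatedEdges.exists_square {G : SimpleGraph W} (h : Gᶜ.HasSeparatedEdges) :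
    ∃ x y z w, x ≠ y ∧ z ≠ w ∧ ¬ G.Adj x y ∧ ¬ G.Adj z w ∧ G.Adj x z ∧ G.Adj x w ∧ G.Adj y z ∧
      G.Adj y w ∧ ∀ v, (¬ Gᶜ.Adj v x ∧ ¬ Gᶜ.Adj v y) ∨ (¬ Gᶜ.Adj v z ∧ ¬ Gᶜ.Adj v w) := by
  obtain ⟨x, y, z, w, hxy, hzw, hxz⟩ := h
  have h1 := hxy.reachable
  have h2 := hzw.reachable
  have hxw : ¬ Gᶜ.Reachable x w := fun h => hxz (h.trans h2.symm)
  have hyz : ¬ Gᶜ.Reachable y z := fun h => hxz (h1.trans h)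
  have hyw : ¬ Gᶜ.Reachable y w := fun h => hxw (h1.trans h)
  refine ⟨x, y, z, w, hxy.ne, hzw.ne, (compl_adj _ _ _ |>.1 hxy).2, (compl_adj _ _ _ |>.1 hzw).2,
    adj_of_not_reachable_compl hxz, adj_of_not_reachable_compl hxw,
    adj_of_not_reachable_compl hyz, adj_of_not_reachable_compl hyw, fun v => ?_⟩
  by_contra! hv
  by_cases hx : Gᶜ.Adj v x
  · by_cases hz : Gᶜ.Adj v z
    · exact hxz (hx.reachable.symm.trans hz.reachable)
    · exact hxw (hx.reachable.symm.trans (hv.2 hz).reachable)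
  · by_cases hz : Gᶜ.Adj v z
    · exact hyz ((hv.1 hx).reachable.symm.trans hz.reachable)
    · exact hyw ((hv.1 hx).reachable.symm.trans (hv.2 hz).reachable)

/-- On four vertices the square found by `HasSeparatedEdges.exists_square` is the whole graph. -/
theorem nonempty_iso_two_two_iff [Fintype W] (hW : Fintype.card W = 4) (G : SimpleGraph W) :
    Nonempty (G ≃g completeBipartiteGraph (Fin 2) (Fin 2)) ↔ Gᶜ.HasSeparatedEdges := by
  constructor
  · rintro ⟨e⟩
    exact hasSeparatedEdges_compl_of_iso e hasSeparatedEdges_compl_completeBipartiteGraph_two_two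
  · intro h
    obtain ⟨x, y, z, w, hxy, hzw, nxy, nzw, hxz, hxw, hyz, hyw, -⟩ := h.exists_square
    refine nonempty_iso_of_injective (by simp [hW]) (Sum.elim ![x, y] ![z, w]) ?_ ?_
    · have e1 := hxz.ne
      have e2 := hxw.ne
      have e3 := hyz.ne
      have e4 := hyw.ne
      rintro (a | a) (b | b) <;> fin_cases a <;> fin_cases b <;>
        simp [hxy, hzw, e1, e2, e3, e4, hxy.symm, hzw.symm, e1.symm, e2.symm, e3.symm, e4.symm]
    · rintro (a | a) (b | b) <;> fin_cases a <;> fin_cases b <;>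
        simp [completeBipartiteGraph, nxy, nzw, hxz, hxw, hyz, hyw, hxz.symm, hxw.symm, hyz.symm,
          hyw.symm, G.adj_comm y x, G.adj_comm w z]

section FiveVertices

variable [Fintype W] {G : SimpleGraph W} {x y z w v : W}

theorem nonempty_iso_graphD (hW : Fintype.card W = 5) (hxy : x ≠ y) (hzw : z ≠ w) (hvz : v ≠ z)
    (nxy : ¬ G.Adj x y) (nzw : ¬ G.Adj z w) (nvz : ¬ G.Adj v z)
    (hxz : G.Adj x z) (hxw : G.Adj x w) (hyz : G.Adj y z) (hyw : G.Adj y w)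
    (hvx : G.Adj v x) (hvy : G.Adj v y) (hvw : G.Adj v w) : Nonempty (G ≃g graphD) := by
  -- The corner `0` and the centre `4` of `graphD` are not adjacent, hence `z` and `v` go there; the
  -- non-adjacent pair `x`, `y` takes the corners `1` and `2`.
  refine nonempty_iso_of_injective (by simp [hW]) ![z, x, y, w, v] ?_ ?_
  · have e1 := hxz.ne
    have e2 := hxw.ne
    have e3 := hyz.ne
    have e4 := hyw.ne
    have e5 := hvx.ne
    have e6 := hvy.ne
    have e7 := hvw.ne
    intro a b
    fin_cases a <;> fin_cases b <;>
      simp [hxy, hzw, hvz, e1, e2, e3, e4, e5, e6, e7, hxy.symm, hzw.symm, hvz.symm, e1.symm,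
        e2.symm, e3.symm, e4.symm, e5.symm, e6.symm, e7.symm]
  · intro a b
    fin_cases a <;> fin_cases b <;>
      simp [graphD, nxy, nzw, nvz, hxz, hxw, hyz, hyw, hvx, hvy, hvw, hxz.symm, hxw.symm,
        hyz.symm, hyw.symm, hvx.symm, hvy.symm, hvw.symm, G.adj_comm y x, G.adj_comm w z,
        G.adj_comm z v]

theorem nonempty_iso_two_three (hW : Fintype.card W = 5) (hxy : x ≠ y) (hzw : z ≠ w)
    (hvz : v ≠ z) (hvw : v ≠ w) (nxy : ¬ G.Adj x y) (nzw : ¬ G.Adj z w) (nvz : ¬ G.Adj v z)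
    (nvw : ¬ G.Adj v w) (hxz : G.Adj x z) (hxw : G.Adj x w) (hyz : G.Adj y z) (hyw : G.Adj y w)
    (hvx : G.Adj v x) (hvy : G.Adj v y) :
    Nonempty (G ≃g completeBipartiteGraph (Fin 2) (Fin 3)) := by
  refine nonempty_iso_of_injective (by simp [hW]) (Sum.elim ![x, y] ![z, w, v]) ?_ ?_
  · have e1 := hxz.ne
    have e2 := hxw.ne
    have e3 := hyz.ne
    have e4 := hyw.ne
    have e5 := hvx.ne
    have e6 := hvy.ne
    rintro (a | a) (b | b) <;> fin_cases a <;> fin_cases b <;>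
      simp [hxy, hzw, hvz, hvw, e1, e2, e3, e4, e5, e6, hxy.symm, hzw.symm, hvz.symm, hvw.symm,
        e1.symm, e2.symm, e3.symm, e4.symm, e5.symm, e6.symm]
  · rintro (a | a) (b | b) <;> fin_cases a <;> fin_cases b <;>
      simp [completeBipartiteGraph, nxy, nzw, nvz, nvw, hxz, hxw, hyz, hyw, hvx, hvy, hxz.symm,
        hxw.symm, hyz.symm, hyw.symm, hvx.symm, hvy.symm, G.adj_comm y x, G.adj_comm w z,
        G.adj_comm z v, G.adj_comm w v]

theorem nonempty_iso_wheelGraph_four (hW : Fintype.card W = 5) (hxy : x ≠ y) (hzw : z ≠ w)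
    (nxy : ¬ G.Adj x y) (nzw : ¬ G.Adj z w)
    (hxz : G.Adj x z) (hxw : G.Adj x w) (hyz : G.Adj y z) (hyw : G.Adj y w)
    (hvx : G.Adj v x) (hvy : G.Adj v y) (hvz : G.Adj v z) (hvw : G.Adj v w) :
    Nonempty (G ≃g wheelGraph 4) := by
  refine nonempty_iso_of_injective (by simp [hW])
    (fun a => a.elim v ![x, z, y, w]) ?_ ?_
  · have e1 := hxz.ne
    have e2 := hxw.ne
    have e3 := hyz.ne
    have e4 := hyw.ne
    have e5 := hvx.ne
    have e6 := hvy.ne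
    have e7 := hvz.ne
    have e8 := hvw.ne
    rintro (_ | a) (_ | b) <;> (try fin_cases a) <;> (try fin_cases b) <;>
      simp [hxy, hzw, e1, e2, e3, e4, e5, e6, e7, e8, hxy.symm, hzw.symm,
        e1.symm, e2.symm, e3.symm, e4.symm, e5.symm, e6.symm, e7.symm, e8.symm]
  · rintro (_ | a) (_ | b) <;> (try fin_cases a) <;> (try fin_cases b) <;>
      first
      | exact iff_of_true (by simp [hxz, hxw, hyz, hyw, hvx, hvy, hvz, hvw, hxz.symm,
          hxw.symm, hyz.symm, hyw.symm, hvx.symm, hvy.symm, hvz.symm, hvw.symm]) (by decide)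
      | exact iff_of_false (by simp [nxy, nzw, G.adj_comm y x, G.adj_comm w z]) (by decide)

/-- The fifth vertex is joined to `x` and `y`. Being joined to none, one or both of `z` and `w`
gives `K_{2,3}`, `D` or `W_4`. -/
theorem nonempty_iso_of_fifth (hW : Fintype.card W = 5) (hxy : x ≠ y) (hzw : z ≠ w)
    (hvz : v ≠ z) (hvw : v ≠ w) (nxy : ¬ G.Adj x y) (nzw : ¬ G.Adj z w)
    (hxz : G.Adj x z) (hxw : G.Adj x w) (hyz : G.Adj y z) (hyw : G.Adj y w)
    (hvx : G.Adj v x) (hvy : G.Adj v y) :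
    Nonempty (G ≃g completeBipartiteGraph (Fin 2) (Fin 3)) ∨ Nonempty (G ≃g wheelGraph 4) ∨
      Nonempty (G ≃g graphD) := by
  by_cases h1 : G.Adj v z
  · by_cases h2 : G.Adj v w
    · exact Or.inr (Or.inl (nonempty_iso_wheelGraph_four hW hxy hzw nxy nzw hxz hxw hyz hyw hvx
        hvy h1 h2))
    · exact Or.inr (Or.inr (nonempty_iso_graphD hW hxy hzw.symm hvw nxy
        (fun h => nzw h.symm) h2 hxw hxz hyw hyz hvx hvy h1))
  · by_cases h2 : G.Adj v w
    · exact Or.inr (Or.inr (nonempty_iso_graphD hW hxy hzw hvz nxy nzw h1 hxz hxw hyz hyw hvx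
        hvy h2))
    · exact Or.inl (nonempty_iso_two_three hW hxy hzw hvz hvw nxy nzw h1 h2 hxz hxw hyz hyw hvx
        hvy)

theorem hasSeparatedEdges_compl_iff (hW : Fintype.card W = 5) :
    Gᶜ.HasSeparatedEdges ↔ Nonempty (G ≃g completeBipartiteGraph (Fin 2) (Fin 3)) ∨
      Nonempty (G ≃g wheelGraph 4) ∨ Nonempty (G ≃g graphD) := by
  classical
  constructor
  · intro h
    obtain ⟨x, y, z, w, hxy, hzw, nxy, nzw, hxz, hxw, hyz, hyw, hv⟩ := h.exists_square
    obtain ⟨v, hvn⟩ : ∃ v, v ∉ ({x, y, z, w} : Finset W) := by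
      by_contra! hall
      have h1 : (Finset.univ : Finset W).card ≤ ({x, y, z, w} : Finset W).card :=
        Finset.card_le_card fun v _ => hall v
      have h2 := Finset.card_le_four (a := x) (b := y) (c := z) (d := w)
      rw [Finset.card_univ] at h1
      omega
    simp only [Finset.mem_insert, Finset.mem_singleton, not_or] at hvn
    obtain ⟨vx, vy, vz, vw⟩ := hvn
    -- In `G` the fifth vertex is joined to both ends of one of the two pairs; the second case
    -- exchanges the roles of the pairs.
    rcases hv v with ⟨h1, h2⟩ | ⟨h1, h2⟩
    · simp only [compl_adj, not_and, not_not] at h1 h2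
      exact nonempty_iso_of_fifth hW hxy hzw vz vw nxy nzw hxz hxw hyz hyw (h1 vx) (h2 vy)
    · simp only [compl_adj, not_and, not_not] at h1 h2
      exact nonempty_iso_of_fifth hW hzw hxy vx vy nzw nxy hxz.symm hyz.symm hxw.symm hyw.symm
        (h1 vz) (h2 vw)
  · rintro (⟨⟨e⟩⟩ | ⟨⟨e⟩⟩ | ⟨⟨e⟩⟩)
    · exact hasSeparatedEdges_compl_of_iso e
        hasSeparatedEdges_compl_completeBipartiteGraph_two_three
    · exact hasSeparatedEdges_compl_of_iso e hasSeparatedEdges_compl_wheelGraph_four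
    · exact hasSeparatedEdges_compl_of_iso e hasSeparatedEdges_compl_graphD

-- The three graphs are pairwise non-isomorphic, so the indicator of the disjunction is the sum of
-- the indicators.
open Classical in
theorem ite_hasSeparatedEdges_compl (hW : Fintype.card W = 5) :
    (if Gᶜ.HasSeparatedEdges then 1 else 0 : ℤ) =
      (if Nonempty (G ≃g completeBipartiteGraph (Fin 2) (Fin 3)) then 1 else 0) +
        (if Nonempty (G ≃g wheelGraph 4) then 1 else 0) +
        (if Nonempty (G ≃g graphD) then 1 else 0) := by
  rw [hasSeparatedEdges_compl_iff hW]
  by_cases h2 : Nonempty (G ≃g wheelGraph 4)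
  · obtain ⟨e⟩ := h2
    simp [not_nonempty_iso_wheelGraph e
      (by decide : ∀ x, ∃ y, y ≠ x ∧ ¬ (completeBipartiteGraph (Fin 2) (Fin 3)).Adj x y),
      not_nonempty_iso_wheelGraph e (by decide : ∀ x, ∃ y, y ≠ x ∧ ¬ graphD.Adj x y),
      Nonempty.intro e]
  · by_cases h1 : Nonempty (G ≃g completeBipartiteGraph (Fin 2) (Fin 3))
    · simp [h1, h2, not_nonempty_iso_graphD h1.some]
    · simp [h1, h2]

end FiveVertices

end SimpleGraph

end SmallGraphs

/-! ### Summation over vertex sets of fixed size. -/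

section InducedCounting

namespace SimpleGraph

variable {V : Type v} [Fintype V]

open Classical in
theorem inducedCount_eq_sum {W : Type*} [Fintype W] (G : SimpleGraph V) (H : SimpleGraph W)
    {n : ℕ} (hW : Fintype.card W = n) :
    (G.inducedCount H : ℤ) = ∑ S ∈ Finset.powersetCard n (Finset.univ : Finset V),
      if Nonempty (G.induce (S : Set V) ≃g H) then 1 else 0 := by
  rw [Finset.sum_boole, inducedCount]
  have h : {S : Set V | Nonempty (G.induce S ≃g H)} = (fun S : Finset V => (S : Set V)) ''
      ((Finset.powersetCard n (Finset.univ : Finset V)).filter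
        fun S => Nonempty (G.induce (S : Set V) ≃g H) : Finset (Finset V)) := by
    ext S
    constructor
    · rintro ⟨e⟩
      refine ⟨S.toFinset, ?_, S.coe_toFinset⟩
      rw [Finset.mem_coe, Finset.mem_filter, Finset.mem_powersetCard, Set.coe_toFinset,
        Set.toFinset_card, ← hW]
      exact ⟨⟨Finset.subset_univ _, Fintype.card_congr e.toEquiv⟩, ⟨e⟩⟩
    · rintro ⟨S, hS, rfl⟩
      exact (Finset.mem_filter.1 (Finset.mem_coe.1 hS)).2
  rw [h, Set.ncard_image_of_injective _ Finset.coe_injective, Set.ncard_coe_finset]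

variable [DecidableEq V] (G : SimpleGraph V) [DecidableRel G.Adj]

/-- Removing `x` from `S` leaves an arbitrary `n`-element set of neighbours of `x`. -/
theorem card_powersetCard_universal (x : V) (n : ℕ) :
    ((Finset.powersetCard (n + 1) (Finset.univ : Finset V)).filter
      fun S => x ∈ S ∧ ∀ y ∈ S, y ≠ x → G.Adj x y).card = (G.degree x).choose n := by
  rw [← G.card_neighborFinset_eq_degree, ← Finset.card_powersetCard]
  refine Finset.card_bij' (fun S _ => S.erase x) (fun T _ => insert x T) ?_ ?_ ?_ ?_
  · intro S hS
    simp only [Finset.mem_filter, Finset.mem_powersetCard] at hS ⊢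
    refine ⟨fun y hy => ?_, ?_⟩
    · rw [mem_neighborFinset]
      exact hS.2.2 y (Finset.mem_of_mem_erase hy) (Finset.ne_of_mem_erase hy)
    · rw [Finset.card_erase_of_mem hS.2.1, hS.1.2]
      rfl
  · intro T hT
    simp only [Finset.mem_filter, Finset.mem_powersetCard] at hT ⊢
    have hx : x ∉ T := fun h => by simpa using hT.1 h
    refine ⟨⟨Finset.subset_univ _, ?_⟩, Finset.mem_insert_self _ _, fun y hy hyx => ?_⟩
    · rw [Finset.card_insert_of_notMem hx, hT.2]
    · exact (mem_neighborFinset _ _ _).1 (hT.1 ((Finset.mem_insert.1 hy).resolve_left hyx))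
  · intro S hS
    exact Finset.insert_erase (Finset.mem_filter.1 hS).2.1
  · intro T hT
    refine Finset.erase_insert fun h => ?_
    simpa using (Finset.mem_powersetCard.1 hT).1 h

theorem ncard_universal_induce (S : Finset V) :
    {x : (S : Set V) | ∀ y, y ≠ x → (G.induce (S : Set V)).Adj x y}.ncard =
      ((Finset.univ : Finset V).filter
        fun x => x ∈ S ∧ ∀ y ∈ S, y ≠ x → G.Adj x y).card := by
  rw [← Set.ncard_image_of_injective _ Subtype.val_injective, ← Set.ncard_coe_finset]
  congr 1
  ext x
  simp only [Finset.coe_filter, Finset.mem_univ, true_and]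
  constructor
  · rintro ⟨x, hx, rfl⟩
    exact ⟨x.2, fun y hy hyx => hx ⟨y, hy⟩ fun h => hyx (congrArg Subtype.val h)⟩
  · rintro ⟨hxS, hx⟩
    exact ⟨⟨x, hxS⟩, fun y hyx => hx y y.2 fun h => hyx (Subtype.ext h), rfl⟩

/-- Double counting of the pairs of a set and a vertex of it that is joined to all the others. -/
theorem sum_ncard_universal_induce (n : ℕ) :
    ∑ S ∈ Finset.powersetCard (n + 1) (Finset.univ : Finset V),
      ({x : (S : Set V) | ∀ y, y ≠ x → (G.induce (S : Set V)).Adj x y}.ncard : ℤ) =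
      ∑ x : V, ((G.degree x).choose n : ℤ) := by
  simp only [ncard_universal_induce, ← card_powersetCard_universal, Finset.card_filter]
  push_cast
  exact Finset.sum_comm

open Classical in
theorem sum_card_connectedComponent_compl (n : ℕ) (hn : n + 1 ≤ 5) :
    ∑ S ∈ Finset.powersetCard (n + 1) (Finset.univ : Finset V),
      ((Nat.card (G.induce (S : Set V))ᶜ.ConnectedComponent : ℤ) - 1) =
      ∑ x : V, ((G.degree x).choose n : ℤ) - G.inducedCount (completeGraph (Fin (n + 1))) +
        ∑ S ∈ Finset.powersetCard (n + 1) (Finset.univ : Finset V),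
          if (G.induce (S : Set V))ᶜ.HasSeparatedEdges then 1 else 0 := by
  rw [← sum_ncard_universal_induce, inducedCount_eq_sum G _ (Fintype.card_fin (n + 1)),
    ← Finset.sum_sub_distrib, ← Finset.sum_add_distrib]
  refine Finset.sum_congr rfl fun S hS => ?_
  have hcard : Fintype.card (S : Set V) = n + 1 := by
    rw [← (Finset.mem_powersetCard.1 hS).2]
    simp
  rw [card_connectedComponent_compl_sub_one _ (hcard.trans_le hn)]
  simp only [nonempty_iso_completeGraph_iff _ hcard]

end SimpleGraph

end InducedCounting

theorem proposition2p8 {k : Type u} [Field k] {V : Type v} [Fintype V] [DecidableEq V]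
    (G : SimpleGraph V) [DecidableRel G.Adj] :
    Nonempty (GradedFreeResolution.{u, v, w} (G.edgeIdeal k)) ∧
    ∀ F : GradedFreeResolution.{u, v, w} (G.edgeIdeal k),
      (Module.Finite k (F.Tor 2 4) ∧
        (F.betti 2 4 : ℤ) =
          (∑ x : V, ((G.degree x).choose 3 : ℤ))
            - G.inducedCount (SimpleGraph.completeGraph (Fin 4))
            + G.inducedCount (completeBipartiteGraph (Fin 2) (Fin 2))) ∧
      (Module.Finite k (F.Tor 3 5) ∧
        (F.betti 3 5 : ℤ) =
          (∑ x : V, ((G.degree x).choose 4 : ℤ))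
            - G.inducedCount (SimpleGraph.completeGraph (Fin 5))
            + G.inducedCount (completeBipartiteGraph (Fin 2) (Fin 3))
            + G.inducedCount (SimpleGraph.wheelGraph 4)
            + G.inducedCount SimpleGraph.graphD) := by
  classical
  refine ⟨nonempty_gradedFreeResolution _ fun f hf j =>
    SimpleGraph.homogeneousComponent_mem_edgeIdeal hf j, fun F => ⟨?_, ?_⟩⟩
  -- The index is one less than the homological degree, so `1` gives `β_{2,4}` and vertex sets of
  -- size four.
  · obtain ⟨h1, h2⟩ := betti_edgeIdeal_linear F 1
    refine ⟨h1, h2.trans ?_⟩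
    rw [G.sum_card_connectedComponent_compl 3 (by norm_num),
      SimpleGraph.inducedCount_eq_sum G (completeBipartiteGraph (Fin 2) (Fin 2)) (n := 4) (by simp)]
    congr 1
    refine Finset.sum_congr rfl fun S hS => ?_
    simp only [SimpleGraph.nonempty_iso_two_two_iff
      (by simpa using (Finset.mem_powersetCard.1 hS).2 : Fintype.card (S : Set V) = 4)]
  · obtain ⟨h1, h2⟩ := betti_edgeIdeal_linear F 2
    refine ⟨h1, h2.trans ?_⟩
    rw [G.sum_card_connectedComponent_compl 4 (by norm_num),
      SimpleGraph.inducedCount_eq_sum G (completeBipartiteGraph (Fin 2) (Fin 3)) (n := 5) (by simp),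
      SimpleGraph.inducedCount_eq_sum G (SimpleGraph.wheelGraph 4) (n := 5) (by simp),
      SimpleGraph.inducedCount_eq_sum G SimpleGraph.graphD (n := 5) (by simp), add_assoc, add_assoc,
      ← Finset.sum_add_distrib, ← Finset.sum_add_distrib]
    congr 1
    refine Finset.sum_congr rfl fun S hS => ?_
    rw [SimpleGraph.ite_hasSeparatedEdges_compl
      (by simpa using (Finset.mem_powersetCard.1 hS).2 : Fintype.card (S : Set V) = 5), add_assoc]
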